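/- Let $\gamma\in[-1,1]$. A complex $N\times N$ Gaussian elliptic matrix with parameter $\gamma$ is a random matrix $(X_{ij})_{i,j=1}^N$ such that: the random elements $X_{ii}$ ($1\le i\le N$) and $(X_{ij},X_{ji})$ ($1\le i<j\le N$) are independent; the pairs $(X_{ij},X_{ji})$, $i<j$, are identically distributed centered jointly Gaussian complex vectors with $\mathbb E X_{ij}^2=\mathbb E X_{ji}^2=\mathbb E X_{ij}\overline{X_{ji}}=0$, $\mathbb E|X_{ij}|^2=\mathbb E|X_{ji}|^2=1$ and $\mathbb E X_{ij}X_{ji}=\gamma$; and the $X_{ii}$ are identically distributed centered complex Gaussian variables with $\mathbb E|X_{ii}|^2=1$ and $\mathbb E X_{ii}^2=\gamma$. For every $N$ let $X=X_N=N^{-1/2}(X_{ij})_{i,j=1}^N$ be the normalized matrix, let $\operatorname{Tr}$ be the unnormalized trace, and write $\operatorname{Cov}(\xi,\eta)=\mathbb E(\xi\eta)-\mathbb E(\xi)\,\mathbb E(\eta)$ (without complex conjugation). Then $\operatorname{Tr}X^r$, $\operatorname{Tr}(X^*)^r$ and $\operatorname{Tr}(XX^*)^r$ are square integrable for all $r\ge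 0$, and for all integers $p,q\ge1$ the following limits exist and have the stated values: $$\lim_{N\to\infty}\operatorname{Cov}\bigl(\operatorname{Tr}X^p,\operatorname{Tr}X^q\bigr)=\sum_{a=1}^{\min\{p,q\}}a\,\gamma^{\frac{p+q}{2}}\binom{p}{\frac{p-a}{2}}\binom{q}{\frac{q-a}{2}},$$ $$\lim_{N\to\infty}\operatorname{Cov}\bigl(\operatorname{Tr}X^p,\operatorname{Tr}(X^*)^q\bigr)=\sum_{a=1}^{\min\{p,q\}}a\,\gamma^{\frac{p+q}{2}-a}\binom{p}{\frac{p-a}{2}}\binom{q}{\frac{q-a}{2}},$$ $$\lim_{N\to\infty}\operatorname{Cov}\bigl(\operatorname{Tr}(XX^*)^p,\operatorname{Tr}(XX^*)^q\bigr)=\sum_{a=1}^{\min\{p,q\}}a\,(\gamma^{2a}+1)\binom{2p}{p-a}\binom{2q}{q-a}.$$ Here $\binom{n}{(n-a)/2}$ is understood to be $0$ when $n-a$ is odd, a summand containing such a factor is $0$ (so the first two sums run only over $a\equiv p\equiv q \pmod 2$), and $\gamma^0=1$ also for $\gamma=0$. -/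

import Mathlib

open MeasureTheory ProbabilityTheory

/-- `X` is an (unnormalized) complex `N × N` Gaussian elliptic matrix with parameter `γ` under `P`.
"Gaussian" is joint Gaussianity over `ℝ`, possibly degenerate. The identical distribution of the
pairs (and of the diagonal entries) need not be required separately, since a centered Gaussian law
on `ℂ × ℂ` (on `ℂ`) is determined by the listed second moments. -/
structure IsGaussianElliptic {Ω : Type*} [MeasurableSpace Ω] {N : ℕ} (γ : ℝ)
    (X : Ω → Matrix (Fin N) (Fin N) ℂ) (P : Measure Ω) : Prop where
  /-- The diagonal entries `X i i` and the pairs `(X i j, X j i)`, `i < j`, are independent.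
  (A diagonal entry appears as `(X i i, X i i)`, which generates the same σ-algebra as `X i i`.) -/
  indep : iIndepFun
    (fun (e : {e : Fin N × Fin N // e.1 ≤ e.2}) (ω : Ω) => (X ω e.1.1 e.1.2, X ω e.1.2 e.1.1)) P
  offDiag_gaussian : ∀ i j, i ≠ j → HasGaussianLaw (fun ω => (X ω i j, X ω j i)) P
  offDiag_mean : ∀ i j, i ≠ j → ∫ ω, X ω i j ∂P = 0
  offDiag_sq : ∀ i j, i ≠ j → ∫ ω, X ω i j ^ 2 ∂P = 0
  offDiag_mul_conj : ∀ i j, i ≠ j → ∫ ω, X ω i j * star (X ω j i) ∂P = 0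
  offDiag_norm_sq : ∀ i j, i ≠ j → ∫ ω, ‖X ω i j‖ ^ 2 ∂P = 1
  offDiag_mul : ∀ i j, i ≠ j → ∫ ω, X ω i j * X ω j i ∂P = (γ : ℂ)
  diag_gaussian : ∀ i, HasGaussianLaw (fun ω => X ω i i) P
  diag_mean : ∀ i, ∫ ω, X ω i i ∂P = 0
  diag_norm_sq : ∀ i, ∫ ω, ‖X ω i i‖ ^ 2 ∂P = 1
  diag_sq : ∀ i, ∫ ω, X ω i i ^ 2 ∂P = (γ : ℂ)

/-- The normalization `N^{-1/2} X` of an `N × N` random matrix. -/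
noncomputable def normalizedMatrix {Ω : Type*} {N : ℕ} (X : Ω → Matrix (Fin N) (Fin N) ℂ) (ω : Ω) :
    Matrix (Fin N) (Fin N) ℂ :=
  (((Real.sqrt N)⁻¹ : ℝ) : ℂ) • X ω

/-- The bilinear covariance `κ₂(ξ, η) = E[ξ η] - E[ξ] E[η]` of complex random variables
(without complex conjugation). -/
noncomputable def kappaTwo {Ω : Type*} [MeasurableSpace Ω] (ξ η : Ω → ℂ) (P : Measure Ω) : ℂ :=
  (∫ ω, ξ ω * η ω ∂P) - (∫ ω, ξ ω ∂P) * (∫ ω, η ω ∂P)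

/-- The binomial coefficient `C(n, (n - a) / 2)` for `a ≤ n`, which is `0` by convention when
`(n - a) / 2` is not an integer. -/
def halfChoose (n a : ℕ) : ℕ :=
  if Even (n - a) then n.choose ((n - a) / 2) else 0

/-! The proof runs on loop (Schwinger–Dyson) equations. All covariances of entries of `X` and `X*`
have the form `E[A^s_{ij} A^t_{kl}] = c s t δ_{il} δ_{jk} / N`, with `c s t = γ` for equal letters
and `1` for different ones. Gaussian integration by parts in the first letter of a word
(`IsLoopFunctional.map_wordTrace_cons_mul`) therefore expresses a trace moment by shorter ones: the
first letter pairs with a letter of its own word, which splits the trace in two, or with a letter of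
another trace, which joins the two traces.

Each such step removes two letters. Induction on the total length shows that normalized means and
all mixed moments of centered traces are bounded in `N` (`isBigO_meanTrace_and_centeredProd`), so
the terms carrying a spare factor `1/N` disappear in the limit. What remains is a planar recursion:
means count weighted noncrossing pairings, and covariances count noncrossing pairings of an annulus
with at least one through string.

The three statistics are traces of words `s, σ s, σ (σ s), …` with an involution `σ`: the identity
for `X^p` and `(X*)^q`, negation for `(XX*)^p`. On these words the recursion closes. Pairs inside a
word have weight `α = c s (σ s)`, through strings have a weight `β` depending only on the relative
rotation, and the limits are the path counts `ballotWeight`, `twoRunWeight` and `runCovariance`.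
That the explicit sum `annularWeight` solves the covariance recursion (`annularWeight_succ_succ`)
follows from a first return decomposition and the ballot theorem. Binomial formulas for free walks
then give the stated values. -/

/-! ### Gaussian integration by parts for polynomials -/

section GaussianStein

open scoped ENNReal

variable {Ω : Type*} [MeasurableSpace Ω] {P : Measure Ω}

lemma deriv_gaussian_exp (v : ℝ) :
    deriv (fun t : ℝ => Real.exp (v * t ^ 2 / 2)) =
      fun t => v * (t * Real.exp (v * t ^ 2 / 2)) := by
  ext t
  have h : HasDerivAt (fun t : ℝ => v * t ^ 2 / 2) (v * t) t := by
    have := (((hasDerivAt_id t).pow 2).const_mul v).div_const 2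
    refine this.congr_deriv ?_
    simp; ring
  rw [h.exp.deriv]; ring

/-- This is the Leibniz rule applied to `f' = v t f`. At `n = 0` the truncated index `n - 1` is
harmless, because its coefficient is `0`. Evaluated at `t = 0` it becomes the moment recursion. -/
lemma iteratedDeriv_gaussian_exp (v : ℝ) (n : ℕ) (t : ℝ) :
    iteratedDeriv (n + 1) (fun t : ℝ => Real.exp (v * t ^ 2 / 2)) t =
      v * (t * iteratedDeriv n (fun t : ℝ => Real.exp (v * t ^ 2 / 2)) t +
        n * iteratedDeriv (n - 1) (fun t : ℝ => Real.exp (v * t ^ 2 / 2)) t) := by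
  set f : ℝ → ℝ := fun t : ℝ => Real.exp (v * t ^ 2 / 2) with hf
  have hsm : ContDiff ℝ ⊤ f := by fun_prop
  have hd : ∀ (k : ℕ) (x : ℝ), HasDerivAt (iteratedDeriv k f) (iteratedDeriv (k + 1) f x) x := by
    intro k x
    rw [iteratedDeriv_succ]
    exact ((hsm.differentiable_iteratedDeriv k
      (WithTop.coe_lt_top _)) x).hasDerivAt
  induction n generalizing t with
  | zero => simp [iteratedDeriv_one, hf, deriv_gaussian_exp]
  | succ n ih =>
    have h1 : iteratedDeriv (n + 1) f = fun t => v * (t * iteratedDeriv n f t +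
        n * iteratedDeriv (n - 1) f t) := funext ih
    have h3 : iteratedDeriv (n + 1 + 1) f t = deriv (fun t => v * (t * iteratedDeriv n f t +
        n * iteratedDeriv (n - 1) f t)) t := by rw [iteratedDeriv_succ, h1]
    rw [h3]
    have h2 := (((hasDerivAt_id t).mul (hd n t)).add ((hd (n - 1) t).const_mul (n : ℝ))).const_mul v
    refine (h2.deriv).trans ?_
    cases n with
    | zero => simp only [id]; push_cast; ring
    | succ n => simp only [id, Nat.add_sub_cancel]; push_cast; ring

/-- The moment recursion of a centered real Gaussian variable. -/
lemma integral_pow_succ_of_hasGaussianLaw {g : Ω → ℝ} (hg : HasGaussianLaw g P)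
    (h0 : ∫ ω, g ω ∂P = 0) (n : ℕ) :
    ∫ ω, g ω ^ (n + 1) ∂P = Var[g; P] * (n * ∫ ω, g ω ^ (n - 1) ∂P) := by
  have hmap := hg.map_eq_gaussianReal
  rw [h0] at hmap
  have hm : ∀ k : ℕ, ∫ ω, g ω ^ k ∂P =
      iteratedDeriv k (fun t : ℝ => Real.exp ((Var[g; P]).toNNReal * t ^ 2 / 2)) 0 := by
    intro k
    have h1 : ∫ ω, g ω ^ k ∂P = ∫ x, x ^ k ∂(P.map g) :=
      (integral_map (f := fun x : ℝ => x ^ k) hg.aemeasurable (by fun_prop)).symm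
    have h2 := iteratedDeriv_mgf_zero (X := fun x : ℝ => x)
      (μ := gaussianReal 0 (Var[g; P]).toNNReal) (by simp) k
    rw [h1, hmap]
    rw [mgf_fun_id_gaussianReal] at h2
    simp only [zero_mul, zero_add] at h2
    rw [h2]; rfl
  rw [hm, hm, iteratedDeriv_gaussian_exp]
  simp [variance_nonneg]

variable {ι : Type*}

/-- Expansion of a polynomial along the line `t ↦ x + t • c`. -/
noncomputable def lineExpansion (c : ι → ℂ) :
    MvPolynomial ι ℂ →ₐ[ℂ] Polynomial (MvPolynomial ι ℂ) :=
  MvPolynomial.aeval fun i =>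
    Polynomial.C (MvPolynomial.X i) + Polynomial.C (MvPolynomial.C (c i)) * Polynomial.X

lemma eval₂_lineExpansion (c : ι → ℂ) (x : ι → ℂ) (t : ℂ) (p : MvPolynomial ι ℂ) :
    (lineExpansion c p).eval₂ (MvPolynomial.eval x) t =
      MvPolynomial.eval (fun i => x i + c i * t) p := by
  induction p using MvPolynomial.induction_on with
  | C a =>
    have : lineExpansion c (MvPolynomial.C a) = Polynomial.C (MvPolynomial.C a) := by
      simp [lineExpansion]
    simp [this]
  | add p q hp hq => simp [Polynomial.eval₂_add, hp, hq]
  | mul_X p i hp =>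
    have : lineExpansion c (MvPolynomial.X i) =
        Polynomial.C (MvPolynomial.X i) + Polynomial.C (MvPolynomial.C (c i)) * Polynomial.X := by
      simp [lineExpansion]
    simp [Polynomial.eval₂_mul, Polynomial.eval₂_add, hp, this]

variable [Fintype ι] {Z : Ω → ι → ℂ}

lemma memLp_eval_of_hasGaussianLaw (hZ : HasGaussianLaw Z P) (p : MvPolynomial ι ℂ)
    {r : ℝ≥0∞} (hr : r ≠ ∞) : MemLp (fun ω => MvPolynomial.eval (Z ω) p) r P := by
  have := hZ.isProbabilityMeasure
  induction p using MvPolynomial.induction_on generalizing r with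
  | C a => simpa using memLp_const a
  | add p q hp hq =>
    simp only [map_add]
    exact (hp hr).add (hq hr)
  | mul_X p i hp =>
    have h2 : 2 * r ≠ ∞ := ENNReal.mul_ne_top (by simp) hr
    have : ENNReal.HolderTriple (2 * r) (2 * r) r := ⟨by
      rw [ENNReal.mul_inv (by simp) (by simp), ← add_mul, ENNReal.inv_two_add_inv_two, one_mul]⟩
    have hi : MemLp (fun ω => Z ω i) (2 * r) P :=
      -- Multiplication by one more variable costs a Hölder step from exponent `2r` to `r`; hence
      -- the induction over all finite exponents at once.
      ((hZ.map_fun (ContinuousLinearMap.proj (R := ℝ) (φ := fun _ : ι => ℂ) i)).memLp h2)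
    simpa using hi.mul' (hp h2)

lemma integrable_eval_of_hasGaussianLaw (hZ : HasGaussianLaw Z P) (p : MvPolynomial ι ℂ) :
    Integrable (fun ω => MvPolynomial.eval (Z ω) p) P :=
  memLp_one_iff_integrable.1 (memLp_eval_of_hasGaussianLaw hZ p (by simp))

lemma derivative_lineExpansion (c : ι → ℂ) (p : MvPolynomial ι ℂ) :
    (lineExpansion c p).derivative =
      ∑ i, Polynomial.C (MvPolynomial.C (c i)) * lineExpansion c (MvPolynomial.pderiv i p) := by
  classical
  induction p using MvPolynomial.induction_on with
  | C a =>
    have : lineExpansion c (MvPolynomial.C a) = Polynomial.C (MvPolynomial.C a) := by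
      simp [lineExpansion]
    simp [this]
  | add p q hp hq => simp [hp, hq, mul_add, Finset.sum_add_distrib]
  | mul_X p i hp =>
    have hX : lineExpansion c (MvPolynomial.X i) =
        Polynomial.C (MvPolynomial.X i) + Polynomial.C (MvPolynomial.C (c i)) * Polynomial.X := by
      simp [lineExpansion]
    have h1 : ∀ j, lineExpansion c (MvPolynomial.pderiv j (p * MvPolynomial.X i)) =
        lineExpansion c (MvPolynomial.X i) * lineExpansion c (MvPolynomial.pderiv j p) +
          if j = i then lineExpansion c p else 0 := by
      intro j
      rw [Derivation.leibniz, MvPolynomial.pderiv_X]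
      by_cases h : j = i
      · subst h; simp [add_comm]
      · simp [h, Ne.symm h]
    simp only [h1, mul_add, Finset.sum_add_distrib, map_mul, Polynomial.derivative_mul, hp,
      mul_ite, mul_zero, Finset.sum_ite_eq', Finset.mem_univ, if_true, Finset.sum_mul]
    refine congrArg₂ (· + ·) (Finset.sum_congr rfl fun j _ => ?_) ?_
    · rw [mul_assoc, mul_comm (lineExpansion c (MvPolynomial.X i))]
    · rw [hX, mul_comm]
      simp

/-- Integration by parts in a real Gaussian variable `g` independent of the coefficients `W`. -/
lemma integral_mul_eval₂_of_indepFun {g : Ω → ℝ} {W : Ω → ι → ℂ} (hg : HasGaussianLaw g P)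
    (hW : HasGaussianLaw W P) (h0 : ∫ ω, g ω ∂P = 0) (hind : IndepFun g W P)
    (Q : Polynomial (MvPolynomial ι ℂ)) :
    ∫ ω, (g ω : ℂ) * Q.eval₂ (MvPolynomial.eval (W ω)) (g ω : ℂ) ∂P =
      (Var[g; P] : ℂ) * ∫ ω, Q.derivative.eval₂ (MvPolynomial.eval (W ω)) (g ω : ℂ) ∂P := by
  have hprod : ∀ (n : ℕ) (r : MvPolynomial ι ℂ),
      ∫ ω, (g ω : ℂ) ^ n * MvPolynomial.eval (W ω) r ∂P =
        ((∫ ω, g ω ^ n ∂P : ℝ) : ℂ) * ∫ ω, MvPolynomial.eval (W ω) r ∂P := by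
    intro n r
    have := hind.integral_fun_comp_mul_comp (f := fun x : ℝ => (x : ℂ) ^ n)
      (g := fun w => MvPolynomial.eval w r) hg.aemeasurable hW.aemeasurable
      (by fun_prop) (MvPolynomial.continuous_eval r).aestronglyMeasurable
    rw [this]
    congr 1
    rw [← integral_complex_ofReal]
    simp
  have hint : ∀ (n : ℕ) (r : MvPolynomial ι ℂ),
      Integrable (fun ω => (g ω : ℂ) ^ n * MvPolynomial.eval (W ω) r) P := by
    intro n r
    have hgn : Integrable (fun ω => (g ω : ℂ) ^ n) P := by
      have h1 : Integrable (fun ω => g ω ^ n) P := by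
        have := hg.isProbabilityMeasure
        have h2 := (hg.memLp (p := n) (by simp)).integrable_norm_pow'
        refine h2.congr' (by
          have := hg.aemeasurable
          fun_prop) ?_
        filter_upwards with ω
        simp
      simpa using h1.ofReal (𝕜 := ℂ)
    have hi : IndepFun (fun ω => (g ω : ℂ) ^ n) (fun ω => MvPolynomial.eval (W ω) r) P :=
      hind.comp (φ := fun x : ℝ => (x : ℂ) ^ n) (ψ := fun w => MvPolynomial.eval w r)
        (by fun_prop) (MvPolynomial.continuous_eval r).measurable
    exact hi.integrable_mul hgn (integrable_eval_of_hasGaussianLaw hW r)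
  have hintQ : ∀ Q : Polynomial (MvPolynomial ι ℂ),
      Integrable (fun ω => Q.eval₂ (MvPolynomial.eval (W ω)) (g ω : ℂ)) P := by
    intro Q
    induction Q using Polynomial.induction_on' with
    | add p q hp hq =>
      simp only [Polynomial.eval₂_add]
      exact hp.add hq
    | monomial n r =>
      simp only [Polynomial.eval₂_monomial]
      simpa only [mul_comm] using hint n r
  have hintQ' : ∀ Q : Polynomial (MvPolynomial ι ℂ),
      Integrable (fun ω => (g ω : ℂ) * Q.eval₂ (MvPolynomial.eval (W ω)) (g ω : ℂ)) P := by
    intro Q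
    refine (hintQ (Polynomial.X * Q)).congr (Filter.Eventually.of_forall fun ω => ?_)
    change Polynomial.eval₂ _ _ _ = _
    rw [Polynomial.eval₂_mul, Polynomial.eval₂_X]
  induction Q using Polynomial.induction_on' with
  | add p q hp hq =>
    simp only [Polynomial.eval₂_add, mul_add, Polynomial.derivative_add]
    rw [integral_add (hintQ' p) (hintQ' q), integral_add (hintQ _) (hintQ _), hp, hq, mul_add]
  | monomial n r =>
    simp only [Polynomial.eval₂_monomial, Polynomial.derivative_monomial]
    have e1 : ∀ ω, (g ω : ℂ) * (MvPolynomial.eval (W ω) r * (g ω : ℂ) ^ n) =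
        (g ω : ℂ) ^ (n + 1) * MvPolynomial.eval (W ω) r := fun ω => by ring
    have e2 : ∀ ω, MvPolynomial.eval (W ω) (r * (n : MvPolynomial ι ℂ)) * (g ω : ℂ) ^ (n - 1) =
        (n : ℂ) * ((g ω : ℂ) ^ (n - 1) * MvPolynomial.eval (W ω) r) := fun ω => by
      simp; ring
    simp only [e1, e2]
    rw [integral_const_mul, hprod, hprod, integral_pow_succ_of_hasGaussianLaw hg h0]
    push_cast
    ring

/-- Gaussian regression: with `g = l(Z)` and `c = E[g Z] / Var g`, the remainder `W = Z - g c` is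
uncorrelated with `g`, hence independent of it by joint Gaussianity. A polynomial in `Z` is then a
polynomial in `g` with coefficients in `W`, and one-variable integration by parts applies. -/
lemma integral_dual_mul_eval (hZ : HasGaussianLaw Z P) (h0 : ∫ ω, Z ω ∂P = 0)
    (l : StrongDual ℝ (ι → ℂ)) (p : MvPolynomial ι ℂ) :
    ∫ ω, (l (Z ω) : ℂ) * MvPolynomial.eval (Z ω) p ∂P =
      ∑ i, (∫ ω, (l (Z ω) : ℂ) * Z ω i ∂P) *
        ∫ ω, MvPolynomial.eval (Z ω) (MvPolynomial.pderiv i p) ∂P := by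
  have hprob := hZ.isProbabilityMeasure
  set g : Ω → ℝ := fun ω => l (Z ω) with hgdef
  have hg : HasGaussianLaw g P := hZ.map_fun l
  have hg0 : ∫ ω, g ω ∂P = 0 := by
    rw [hgdef, l.integral_comp_comm hZ.integrable, h0, map_zero]
  -- The law may be degenerate. If `Var g = 0` then `g = 0` almost surely and both sides vanish.
  by_cases hv : Var[g; P] = 0
  · have hz : ∀ᵐ ω ∂P, g ω = 0 := by
      have := ae_eq_integral_of_variance_eq_zero hg.memLp_two hv
      filter_upwards [this] with ω h
      rw [h, hg0]
    have h1 : ∀ f : Ω → ℂ, ∫ ω, (g ω : ℂ) * f ω ∂P = 0 := by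
      intro f
      rw [integral_eq_zero_of_ae]
      filter_upwards [hz] with ω h
      simp [h]
    rw [h1]
    exact (Finset.sum_eq_zero fun i _ => by rw [h1 (fun ω => Z ω i), zero_mul]).symm
  · have hvC : (Var[g; P] : ℂ) ≠ 0 := by exact_mod_cast hv
    have hgZ : Integrable (fun ω => g ω • Z ω) P := by
      have := (hZ.memLp_two).smul (r := 1) hg.memLp_two
      exact memLp_one_iff_integrable.1 this
    set c : ι → ℂ := (Var[g; P])⁻¹ • ∫ ω, g ω • Z ω ∂P with hc
    have hci : ∀ i, (Var[g; P] : ℂ) * c i = ∫ ω, (g ω : ℂ) * Z ω i ∂P := by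
      intro i
      have h1 : (∫ ω, g ω • Z ω ∂P) i = ∫ ω, (g ω : ℂ) * Z ω i ∂P := by
        have := (ContinuousLinearMap.proj (R := ℝ) (φ := fun _ : ι => ℂ) i).integral_comp_comm hgZ
        simpa using this.symm
      rw [hc, Pi.smul_apply, h1, Complex.real_smul]
      push_cast
      field_simp
    let S : (ι → ℂ) →L[ℝ] (ι → ℂ) := ContinuousLinearMap.id ℝ _ - l.smulRight c
    set W : Ω → ι → ℂ := fun ω => S (Z ω) with hWdef
    have hWapp : ∀ ω, W ω = Z ω - g ω • c := fun ω => by simp [hWdef, S, hgdef]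
    have hW : HasGaussianLaw W P := hZ.map_fun S
    have hind : IndepFun g W P := by
      refine (hZ.map_fun (l.prod S)).indepFun_of_covariance_strongDual fun L₁ L₂ => ?_
      have hL1 : L₁ ∘ g = fun ω => L₁ 1 * g ω := by
        ext ω
        have : L₁ (g ω • (1 : ℝ)) = g ω • L₁ 1 := map_smul _ _ _
        simpa [mul_comm] using this
      change cov[L₁ ∘ g, L₂ ∘ W; P] = 0
      rw [hL1, covariance_const_mul_left]
      have hcov : cov[g, L₂ ∘ W; P] = 0 := by
        rw [covariance_eq_sub hg.memLp_two (hW.map L₂).memLp_two, hg0, zero_mul, sub_zero]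
        have h2 : ∀ ω, (g * (L₂ ∘ W)) ω = L₂ (g ω • Z ω) - g ω ^ 2 * L₂ c := by
          intro ω
          simp [hWapp]; ring
        have hi1 : Integrable (fun ω => L₂ (g ω • Z ω)) P := L₂.integrable_comp hgZ
        have hi2 : Integrable (fun ω => g ω ^ 2) P := hg.memLp_two.integrable_sq
        have hvar : ∫ ω, g ω ^ 2 ∂P = Var[g; P] :=
          (variance_of_integral_eq_zero hg.aemeasurable hg0).symm
        simp_rw [h2]
        rw [integral_sub hi1 (hi2.mul_const _), integral_mul_const, hvar,
          L₂.integral_comp_comm hgZ, hc, map_smul, smul_eq_mul, mul_inv_cancel_left₀ hv, sub_self]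
      rw [hcov, mul_zero]
    have hZW : ∀ ω, Z ω = fun i => W ω i + c i * (g ω : ℂ) := by
      intro ω; ext i; rw [hWapp]; simp [mul_comm]
    have hexp : ∀ (q : MvPolynomial ι ℂ) (ω : Ω), MvPolynomial.eval (Z ω) q =
        (lineExpansion c q).eval₂ (MvPolynomial.eval (W ω)) (g ω : ℂ) := by
      intro q ω
      rw [eval₂_lineExpansion, ← hZW]
    have hmain := integral_mul_eval₂_of_indepFun hg hW hg0 hind (lineExpansion c p)
    simp only [← hexp] at hmain
    rw [hmain, derivative_lineExpansion]
    simp only [Polynomial.eval₂_finsetSum, Polynomial.eval₂_mul, Polynomial.eval₂_C,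
      MvPolynomial.eval_C, ← hexp]
    rw [integral_finsetSum _ fun i _ =>
      (integrable_eval_of_hasGaussianLaw hZ (MvPolynomial.pderiv i p)).const_mul _, Finset.mul_sum]
    refine Finset.sum_congr rfl fun i _ => ?_
    rw [integral_const_mul, ← mul_assoc, hci]

/-- **Gaussian integration by parts** for polynomials in a centered complex-valued family that is
jointly Gaussian over `ℝ`. -/
theorem integral_mul_eval_of_hasGaussianLaw (hZ : HasGaussianLaw Z P)
    (h0 : ∀ i, ∫ ω, Z ω i ∂P = 0) (i : ι) (p : MvPolynomial ι ℂ) :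
    ∫ ω, Z ω i * MvPolynomial.eval (Z ω) p ∂P =
      ∑ j, (∫ ω, Z ω i * Z ω j ∂P) *
        ∫ ω, MvPolynomial.eval (Z ω) (MvPolynomial.pderiv j p) ∂P := by
  have h0' : ∫ ω, Z ω ∂P = 0 := by
    ext i
    have := (ContinuousLinearMap.proj (R := ℝ) (φ := fun _ : ι => ℂ) i).integral_comp_comm
      hZ.integrable
    simpa [h0] using this.symm
  let R : StrongDual ℝ (ι → ℂ) := Complex.reCLM.comp (ContinuousLinearMap.proj i)
  let I : StrongDual ℝ (ι → ℂ) := Complex.imCLM.comp (ContinuousLinearMap.proj i)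
  have hsplit : ∀ ω, Z ω i = (R (Z ω) : ℂ) + Complex.I * (I (Z ω) : ℂ) := by
    intro ω
    have := Complex.re_add_im (Z ω i)
    simp only [R, I, ContinuousLinearMap.comp_apply, ContinuousLinearMap.proj_apply,
      Complex.reCLM_apply, Complex.imCLM_apply]
    rw [mul_comm Complex.I]; exact this.symm
  have hint : ∀ (l : StrongDual ℝ (ι → ℂ)) (q : MvPolynomial ι ℂ),
      Integrable (fun ω => (l (Z ω) : ℂ) * MvPolynomial.eval (Z ω) q) P := by
    intro l q
    have h1 : MemLp (fun ω => (l (Z ω) : ℂ)) 2 P := (hZ.map_fun l).memLp_two.ofReal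
    have h2 : MemLp (fun ω => MvPolynomial.eval (Z ω) q) 2 P :=
      memLp_eval_of_hasGaussianLaw hZ q (by simp)
    exact memLp_one_iff_integrable.1 (h2.mul' h1)
  have key : ∀ q : MvPolynomial ι ℂ, ∫ ω, Z ω i * MvPolynomial.eval (Z ω) q ∂P =
      (∫ ω, (R (Z ω) : ℂ) * MvPolynomial.eval (Z ω) q ∂P) +
        Complex.I * ∫ ω, (I (Z ω) : ℂ) * MvPolynomial.eval (Z ω) q ∂P := by
    intro q
    rw [← integral_const_mul, ← integral_add (hint R q) ((hint I q).const_mul _)]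
    refine integral_congr_ae (Filter.Eventually.of_forall fun ω => ?_)
    change Z ω i * _ = _
    rw [hsplit]; ring
  have key' : ∀ j, ∫ ω, Z ω i * Z ω j ∂P =
      (∫ ω, (R (Z ω) : ℂ) * Z ω j ∂P) + Complex.I * ∫ ω, (I (Z ω) : ℂ) * Z ω j ∂P := by
    intro j
    simpa using key (MvPolynomial.X j)
  rw [key, integral_dual_mul_eval hZ h0', integral_dual_mul_eval hZ h0', Finset.mul_sum,
    ← Finset.sum_add_distrib]
  refine Finset.sum_congr rfl fun j _ => ?_
  rw [key']; ring

end GaussianStein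

/-! ### Traces of words and the loop equation -/

section WordTraces

/-- Sum over all ways of cutting one letter out of a word. -/
def splitSum {α M : Type*} [Inhabited α] [AddCommMonoid M] (w : List α)
    (f : List α → α → List α → M) : M :=
  ∑ n ∈ Finset.range w.length, f (w.take n) (w.getD n default) (w.drop (n + 1))

lemma splitSum_cons {α M : Type*} [Inhabited α] [AddCommMonoid M] (s : α) (w : List α)
    (f : List α → α → List α → M) :
    splitSum (s :: w) f = splitSum w (fun u t u' => f (s :: u) t u') + f [] s w := by
  simp [splitSum, Finset.sum_range_succ']

/-- Polynomials in the entries of two `N × N` matrices, indexed by `Bool`. -/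
abbrev EntryPoly (N : ℕ) := MvPolynomial (Bool × Fin N × Fin N) ℂ

variable {N : ℕ}

/-- The generic matrix with index `s`. -/
noncomputable def letterMatrix (N : ℕ) (s : Bool) : Matrix (Fin N) (Fin N) (EntryPoly N) :=
  Matrix.of fun i j => MvPolynomial.X (s, i, j)

/-- The product of generic matrices along a word. -/
noncomputable def wordMatrix (N : ℕ) (w : List Bool) : Matrix (Fin N) (Fin N) (EntryPoly N) :=
  (w.map (letterMatrix N)).prod

/-- The trace of a word in the generic matrices. -/
noncomputable def wordTrace (N : ℕ) (w : List Bool) : EntryPoly N := (wordMatrix N w).trace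

lemma wordMatrix_nil : wordMatrix N [] = 1 := rfl

lemma wordMatrix_cons (s : Bool) (w : List Bool) :
    wordMatrix N (s :: w) = letterMatrix N s * wordMatrix N w := by
  simp [wordMatrix]

lemma wordMatrix_append (u w : List Bool) :
    wordMatrix N (u ++ w) = wordMatrix N u * wordMatrix N w := by
  simp [wordMatrix]

lemma wordTrace_nil : wordTrace N [] = N := by
  simp [wordTrace, wordMatrix_nil]

lemma wordTrace_cons (s : Bool) (w : List Bool) :
    wordTrace N (s :: w) = ∑ i, ∑ j, MvPolynomial.X (s, i, j) * wordMatrix N w j i := by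
  simp [wordTrace, wordMatrix_cons, Matrix.trace, Matrix.mul_apply, letterMatrix]

lemma pderiv_wordMatrix (t : Bool) (k l : Fin N) (w : List Bool) (a b : Fin N) :
    MvPolynomial.pderiv (t, k, l) (wordMatrix N w a b) =
      splitSum w fun u t' u' =>
        if t' = t then wordMatrix N u a k * wordMatrix N u' l b else 0 := by
  induction w generalizing a with
  | nil =>
    by_cases h : a = b
    · simp [wordMatrix_nil, splitSum, h]
    · simp [wordMatrix_nil, splitSum, h]
  | cons s w ih =>
    rw [splitSum_cons, wordMatrix_cons, Matrix.mul_apply, map_sum]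
    have h1 : ∀ x, MvPolynomial.pderiv (t, k, l) (letterMatrix N s a x * wordMatrix N w x b) =
        letterMatrix N s a x * (splitSum w fun u t' u' =>
          if t' = t then wordMatrix N u x k * wordMatrix N u' l b else 0) +
        (if x = l then (if s = t then wordMatrix N [] a k * wordMatrix N w l b else 0) else 0) := by
      intro x
      rw [Derivation.leibniz, ih, smul_eq_mul, smul_eq_mul]
      congr 1
      have : MvPolynomial.pderiv (t, k, l) (letterMatrix N s a x) =
          if s = t ∧ a = k ∧ x = l then 1 else 0 := by
        rw [letterMatrix, Matrix.of_apply, MvPolynomial.pderiv_X, Pi.single_apply]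
        simp [Prod.ext_iff]
      rw [this, wordMatrix_nil, Matrix.one_apply]
      by_cases h1 : s = t <;> by_cases h2 : a = k <;> by_cases h3 : x = l <;> simp [h1, h2, h3]
    simp only [h1, Finset.sum_add_distrib, Finset.sum_ite_eq', Finset.mem_univ, if_true]
    congr 1
    simp only [splitSum, Finset.mul_sum]
    rw [Finset.sum_comm]
    refine Finset.sum_congr rfl fun n _ => ?_
    rw [wordMatrix_cons, Matrix.mul_apply]
    split_ifs
    · rw [Finset.sum_mul]
      exact Finset.sum_congr rfl fun x _ => by ring
    · simp

/-- The derivation that acts on traces by joining them with the word `s :: w`. -/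
noncomputable def joinDerivation (N : ℕ) (c : Bool → Bool → ℂ) (s : Bool) (w : List Bool) :
    Derivation ℂ (EntryPoly N) (EntryPoly N) :=
  ∑ i, ∑ j, ∑ t, (MvPolynomial.C (c s t) * wordMatrix N w j i) • MvPolynomial.pderiv (t, j, i)

lemma joinDerivation_apply (c : Bool → Bool → ℂ) (s : Bool) (w : List Bool) (F : EntryPoly N) :
    joinDerivation N c s w F = ∑ i, ∑ j, ∑ t, MvPolynomial.C (c s t) * wordMatrix N w j i *
      MvPolynomial.pderiv (t, j, i) F := by
  have h : ∀ {β : Type} (S : Finset β) (D : β → Derivation ℂ (EntryPoly N) (EntryPoly N)),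
      (∑ x ∈ S, D x) F = ∑ x ∈ S, D x F := by
    intro β S D
    have := map_sum (Derivation.coeFnAddMonoidHom (R := ℂ) (A := EntryPoly N) (M := EntryPoly N))
      D S
    exact (congrFun this F).trans (Finset.sum_apply _ _ _)
  simp [joinDerivation, h]

/-- Cutting the letter `t` out of the cyclic word `u t u'` leaves the open word `u' u`, which closes
up with `w` into a single trace. -/
lemma joinDerivation_wordTrace (c : Bool → Bool → ℂ) (s : Bool) (w v : List Bool) :
    joinDerivation N c s w (wordTrace N v) =
      splitSum v fun u t u' => MvPolynomial.C (c s t) * wordTrace N (w ++ (u' ++ u)) := by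
  have h1 : ∀ t i j, MvPolynomial.pderiv (t, j, i) (wordTrace N v) =
      splitSum v fun u t' u' => if t' = t then wordMatrix N (u' ++ u) i j else 0 := by
    intro t i j
    simp only [wordTrace, Matrix.trace, Matrix.diag, map_sum, pderiv_wordMatrix, splitSum]
    rw [Finset.sum_comm]
    refine Finset.sum_congr rfl fun n _ => ?_
    split_ifs
    · rw [wordMatrix_append, Matrix.mul_apply]
      exact Finset.sum_congr rfl fun x _ => mul_comm _ _
    · simp
  rw [joinDerivation_apply]
  simp only [h1, splitSum, Finset.mul_sum, mul_ite, mul_zero]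
  have h2 : ∀ i j : Fin N, (∑ t, ∑ n ∈ Finset.range v.length,
      if v.getD n default = t then MvPolynomial.C (c s t) * wordMatrix N w j i *
        wordMatrix N (v.drop (n + 1) ++ v.take n) i j else 0) =
      ∑ n ∈ Finset.range v.length, MvPolynomial.C (c s (v.getD n default)) *
        (wordMatrix N w j i * wordMatrix N (v.drop (n + 1) ++ v.take n) i j) := by
    intro i j
    rw [Finset.sum_comm]
    refine Finset.sum_congr rfl fun n _ => ?_
    rw [Finset.sum_ite_eq]
    simp [mul_assoc]
  simp only [h2]
  rw [Finset.sum_comm]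
  simp only [Finset.sum_comm (s := (Finset.univ : Finset (Fin N))) (t := Finset.range v.length)]
  refine Finset.sum_congr rfl fun n _ => ?_
  simp only [← Finset.mul_sum]
  rw [wordTrace, wordMatrix_append w]
  simp only [Matrix.trace, Matrix.diag, Matrix.mul_apply]

/-- Differentiating inside the same trace separates the indices `i` and `j`, so the trace breaks
into two. -/
lemma sum_pderiv_wordMatrix (c : Bool → Bool → ℂ) (s : Bool) (w : List Bool) :
    ∑ i, ∑ j, ∑ t, MvPolynomial.C (c s t) *
      MvPolynomial.pderiv (t, j, i) (wordMatrix N w j i) =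
      splitSum w fun u t u' =>
        MvPolynomial.C (c s t) * (wordTrace N u * wordTrace N u') := by
  simp only [pderiv_wordMatrix, splitSum, Finset.mul_sum, mul_ite, mul_zero]
  have h2 : ∀ i j : Fin N, (∑ t, ∑ n ∈ Finset.range w.length,
      if w.getD n default = t then MvPolynomial.C (c s t) *
        (wordMatrix N (w.take n) j j * wordMatrix N (w.drop (n + 1)) i i) else 0) =
      ∑ n ∈ Finset.range w.length, MvPolynomial.C (c s (w.getD n default)) *
        (wordMatrix N (w.take n) j j * wordMatrix N (w.drop (n + 1)) i i) := by
    intro i j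
    rw [Finset.sum_comm]
    refine Finset.sum_congr rfl fun n _ => ?_
    rw [Finset.sum_ite_eq]
    simp
  simp only [h2]
  rw [Finset.sum_comm]
  simp only [Finset.sum_comm (s := (Finset.univ : Finset (Fin N))) (t := Finset.range w.length)]
  refine Finset.sum_congr rfl fun n _ => ?_
  simp only [← Finset.mul_sum, wordTrace, Matrix.trace, Matrix.diag]
  rw [Finset.sum_mul]

/-- A normalized linear functional on polynomials in the matrix entries satisfying the Gaussian
integration by parts formula with covariance `E[A^s_{ij} A^t_{kl}] = c s t δ_{il} δ_{jk} / N`. -/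
structure IsLoopFunctional (c : Bool → Bool → ℂ) (φ : EntryPoly N →ₗ[ℂ] ℂ) : Prop where
  map_one : φ 1 = 1
  map_X_mul : ∀ s i j p, φ (MvPolynomial.X (s, i, j) * p) =
    (N : ℂ)⁻¹ * ∑ t, c s t * φ (MvPolynomial.pderiv (t, j, i) p)

/-- The loop (Schwinger–Dyson) equation. -/
theorem IsLoopFunctional.map_wordTrace_cons_mul {c : Bool → Bool → ℂ}
    {φ : EntryPoly N →ₗ[ℂ] ℂ} (hφ : IsLoopFunctional c φ) (s : Bool) (w : List Bool)
    (F : EntryPoly N) :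
    φ (wordTrace N (s :: w) * F) =
      (N : ℂ)⁻¹ * (splitSum w fun u t u' => c s t * φ (wordTrace N u * wordTrace N u' * F)) +
        (N : ℂ)⁻¹ * φ (joinDerivation N c s w F) := by
  have hC : ∀ (a : ℂ) (p : EntryPoly N), φ (MvPolynomial.C a * p) = a * φ p := by
    intro a p
    rw [← MvPolynomial.smul_eq_C_mul, map_smul, smul_eq_mul]
  have h1 : (splitSum w fun u t u' => c s t * φ (wordTrace N u * wordTrace N u' * F)) =
      φ ((splitSum w fun u t u' =>
        MvPolynomial.C (c s t) * (wordTrace N u * wordTrace N u')) * F) := by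
    simp only [splitSum, Finset.sum_mul, map_sum, mul_assoc, hC]
  -- Integration by parts in the entry of the first letter; by the Leibniz rule the derivative falls
  -- on the rest of the word (splitting) or on `F` (joining).
  rw [h1, ← sum_pderiv_wordMatrix, ← mul_add, ← map_add, joinDerivation_apply, wordTrace_cons]
  simp only [Finset.sum_mul, mul_assoc, map_sum, hφ.map_X_mul, hC, map_add,
    ← Finset.mul_sum, Derivation.leibniz, smul_eq_mul]
  congr 1
  simp only [← Finset.sum_add_distrib]
  refine Finset.sum_congr rfl fun i _ => Finset.sum_congr rfl fun j _ =>
    Finset.sum_congr rfl fun t _ => ?_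
  rw [mul_comm F]; ring

end WordTraces

/-! ### Bounds and limits for moments of centered traces -/

section CenteredMoments

open Filter Topology Asymptotics

variable {N : ℕ} {c : Bool → Bool → ℂ}

/-- The normalized mean `N⁻¹ φ(Tr w)`. -/
noncomputable def meanTrace (φ : EntryPoly N →ₗ[ℂ] ℂ) (w : List Bool) : ℂ :=
  (N : ℂ)⁻¹ * φ (wordTrace N w)

/-- The centered trace `Tr w - φ(Tr w)`. -/
noncomputable def centeredTrace (φ : EntryPoly N →ₗ[ℂ] ℂ) (w : List Bool) : EntryPoly N :=
  wordTrace N w - MvPolynomial.C (φ (wordTrace N w))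

/-- The product of the centered traces of a list of words. -/
noncomputable def centeredProd (φ : EntryPoly N →ₗ[ℂ] ℂ) (W : List (List Bool)) : EntryPoly N :=
  (W.map (centeredTrace φ)).prod

lemma map_C_mul (φ : EntryPoly N →ₗ[ℂ] ℂ) (a : ℂ) (p : EntryPoly N) :
    φ (MvPolynomial.C a * p) = a * φ p := by
  rw [← MvPolynomial.smul_eq_C_mul, map_smul, smul_eq_mul]

@[simp]
lemma centeredProd_nil (φ : EntryPoly N →ₗ[ℂ] ℂ) : centeredProd φ [] = 1 := rfl

lemma centeredProd_cons (φ : EntryPoly N →ₗ[ℂ] ℂ) (w : List Bool) (W : List (List Bool)) :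
    centeredProd φ (w :: W) = centeredTrace φ w * centeredProd φ W := by
  simp [centeredProd]

lemma centeredProd_append (φ : EntryPoly N →ₗ[ℂ] ℂ) (U W : List (List Bool)) :
    centeredProd φ (U ++ W) = centeredProd φ U * centeredProd φ W := by
  simp [centeredProd]

namespace IsLoopFunctional

variable {φ : EntryPoly N →ₗ[ℂ] ℂ}

lemma map_C (hφ : IsLoopFunctional c φ) (a : ℂ) : φ (MvPolynomial.C a) = a := by
  have := map_C_mul φ a 1
  rwa [mul_one, hφ.map_one, mul_one] at this

lemma centeredTrace_nil (hφ : IsLoopFunctional c φ) : centeredTrace φ [] = 0 := by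
  have : wordTrace N [] = MvPolynomial.C (N : ℂ) := by simp [wordTrace_nil]
  rw [centeredTrace, this, hφ.map_C, sub_self]

lemma meanTrace_nil (hφ : IsLoopFunctional c φ) (hN : N ≠ 0) : meanTrace φ [] = 1 := by
  have : wordTrace N [] = MvPolynomial.C (N : ℂ) := by simp [wordTrace_nil]
  rw [meanTrace, this, hφ.map_C, inv_mul_cancel₀ (by exact_mod_cast hN)]

lemma map_centeredTrace (hφ : IsLoopFunctional c φ) (w : List Bool) :
    φ (centeredTrace φ w) = 0 := by
  rw [centeredTrace, map_sub, hφ.map_C, sub_self]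

lemma wordTrace_eq (hN : N ≠ 0) (w : List Bool) :
    wordTrace N w = centeredTrace φ w + MvPolynomial.C (N * meanTrace φ w) := by
  have : (N : ℂ) ≠ 0 := by exact_mod_cast hN
  rw [centeredTrace, meanTrace, mul_inv_cancel_left₀ this, sub_add_cancel]

lemma map_wordTrace (hN : N ≠ 0) (w : List Bool) :
    φ (wordTrace N w) = N * meanTrace φ w := by
  have : (N : ℂ) ≠ 0 := by exact_mod_cast hN
  rw [meanTrace, mul_inv_cancel_left₀ this]

lemma map_wordTrace_mul (hN : N ≠ 0) (w : List Bool) (F : EntryPoly N) :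
    φ (wordTrace N w * F) = φ (centeredTrace φ w * F) + N * meanTrace φ w * φ F := by
  rw [wordTrace_eq (φ := φ) hN w, add_mul, map_add, map_C_mul]

lemma map_wordTrace_mul_wordTrace_mul (hN : N ≠ 0) (u v : List Bool) (F : EntryPoly N) :
    φ (wordTrace N u * wordTrace N v * F) =
      φ (centeredTrace φ u * (centeredTrace φ v * F)) +
        N * meanTrace φ u * φ (centeredTrace φ v * F) +
        N * meanTrace φ v * φ (centeredTrace φ u * F) +
        N ^ 2 * (meanTrace φ u * meanTrace φ v) * φ F := by
  rw [mul_assoc, map_wordTrace_mul hN, map_wordTrace_mul hN, mul_left_comm, map_wordTrace_mul hN,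
    mul_left_comm]
  ring

lemma map_centeredTrace_mul (φ : EntryPoly N →ₗ[ℂ] ℂ) (w : List Bool) (F : EntryPoly N) :
    φ (centeredTrace φ w * F) = φ (wordTrace N w * F) - φ (wordTrace N w) * φ F := by
  rw [centeredTrace, sub_mul, map_sub, map_C_mul]

lemma map_wordTrace_mul_wordTrace (hφ : IsLoopFunctional c φ) (hN : N ≠ 0) (u v : List Bool) :
    φ (wordTrace N u * wordTrace N v) =
      φ (centeredProd φ [u, v]) + N ^ 2 * (meanTrace φ u * meanTrace φ v) := by
  have := map_wordTrace_mul_wordTrace_mul (φ := φ) hN u v 1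
  simpa [hφ.map_centeredTrace, hφ.map_one, centeredProd_cons] using this

lemma meanTrace_cons (hφ : IsLoopFunctional c φ) (hN : N ≠ 0) (s : Bool) (w : List Bool) :
    meanTrace φ (s :: w) = splitSum w fun u t u' => c s t *
      (meanTrace φ u * meanTrace φ u' + (N : ℂ)⁻¹ * (N : ℂ)⁻¹ * φ (centeredProd φ [u, u'])) := by
  have hN' : (N : ℂ) ≠ 0 := by exact_mod_cast hN
  have h := hφ.map_wordTrace_cons_mul s w 1
  rw [mul_one, Derivation.map_one_eq_zero, map_zero, mul_zero, add_zero] at h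
  rw [meanTrace, h]
  simp only [splitSum, Finset.mul_sum, mul_one, hφ.map_wordTrace_mul_wordTrace hN]
  refine Finset.sum_congr rfl fun n _ => ?_
  field_simp
  ring

/-- Substituting `Tr = centered + N · mean` in the split term of the loop equation, the contribution
of order `N` cancels against the centering. The leading terms are products of a mean with a shorter
centered moment. -/
lemma map_centeredTrace_cons_mul (hφ : IsLoopFunctional c φ) (hN : N ≠ 0) (s : Bool)
    (w : List Bool) (F : EntryPoly N) :
    φ (centeredTrace φ (s :: w) * F) =
      (splitSum w fun u t u' => c s t *
        ((N : ℂ)⁻¹ * (φ (centeredTrace φ u * (centeredTrace φ u' * F)) -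
            φ (centeredProd φ [u, u']) * φ F) +
          (meanTrace φ u * φ (centeredTrace φ u' * F) +
            meanTrace φ u' * φ (centeredTrace φ u * F)))) +
        (N : ℂ)⁻¹ * φ (joinDerivation N c s w F) := by
  have hN' : (N : ℂ) ≠ 0 := by exact_mod_cast hN
  rw [map_centeredTrace_mul, hφ.map_wordTrace_cons_mul, map_wordTrace hN, hφ.meanTrace_cons hN]
  have : ∀ a b d e : ℂ, a - e = d → a + b - e = d + b := by
    intro a b d e h; rw [← h]; ring
  apply this
  simp only [splitSum, Finset.mul_sum, Finset.sum_mul, map_wordTrace_mul_wordTrace_mul hN]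
  rw [← Finset.sum_sub_distrib]
  refine Finset.sum_congr rfl fun n _ => ?_
  field_simp
  ring

lemma map_mul_joinDerivation_centeredTrace (hN : N ≠ 0) (s : Bool) (w v : List Bool)
    (G : EntryPoly N) :
    (N : ℂ)⁻¹ * φ (G * joinDerivation N c s w (centeredTrace φ v)) =
      splitSum v fun u t u' => c s t *
        ((N : ℂ)⁻¹ * φ (centeredTrace φ (w ++ (u' ++ u)) * G) +
          meanTrace φ (w ++ (u' ++ u)) * φ G) := by
  have hN' : (N : ℂ) ≠ 0 := by exact_mod_cast hN
  have h0 : joinDerivation N c s w (MvPolynomial.C (φ (wordTrace N v))) = 0 :=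
    Derivation.map_algebraMap _ _
  rw [centeredTrace, map_sub, h0, sub_zero, joinDerivation_wordTrace]
  simp only [splitSum, Finset.mul_sum, map_sum]
  refine Finset.sum_congr rfl fun n _ => ?_
  rw [mul_left_comm, map_C_mul, mul_comm G, map_wordTrace_mul hN]
  field_simp

end IsLoopFunctional

variable {φ : ∀ N, EntryPoly N →ₗ[ℂ] ℂ}

/-- The total number of letters in a list of words. -/
def totalLength (W : List (List Bool)) : ℕ := (W.map List.length).sum

lemma isBigO_natCast_inv : (fun N : ℕ => ((N : ℂ))⁻¹) =O[atTop] (fun _ => (1 : ℝ)) :=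
  (tendsto_inv_atTop_nhds_zero_nat (𝕜 := ℂ)).isBigO_one ℝ

lemma isBigO_one_mul {f g : ℕ → ℂ} (hf : f =O[atTop] (fun _ => (1 : ℝ)))
    (hg : g =O[atTop] (fun _ => (1 : ℝ))) :
    (fun N => f N * g N) =O[atTop] (fun _ => (1 : ℝ)) := by
  simpa using hf.mul hg

lemma isBigO_splitSum {w : List Bool} {f : ℕ → List Bool → Bool → List Bool → ℂ}
    (h : ∀ u t u', u.length + u'.length + 1 = w.length →
      (fun N => f N u t u') =O[atTop] (fun _ => (1 : ℝ))) :
    (fun N => splitSum w (f N)) =O[atTop] (fun _ => (1 : ℝ)) := by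
  simp only [splitSum]
  refine IsBigO.fun_sum fun n hn => h _ _ _ ?_
  rw [Finset.mem_range] at hn
  simp
  omega

/-- A joined trace is of order `N`, which the prefactor `1/N` absorbs. The list `U` collects the
factors that the Leibniz rule has already passed, so that the induction can run along `V`. -/
lemma isBigO_joinDerivation {n : ℕ}
    (hm : ∀ w : List Bool, w.length < n →
      (fun N => meanTrace (φ N) w) =O[atTop] (fun _ => (1 : ℝ)))
    (hA : ∀ W, totalLength W < n →
      (fun N => φ N (centeredProd (φ N) W)) =O[atTop] (fun _ => (1 : ℝ)))
    (s : Bool) (w : List Bool) (V : List (List Bool)) :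
    ∀ U, w.length + 1 + totalLength U + totalLength V ≤ n →
    (fun N : ℕ => (N : ℂ)⁻¹ * φ N (centeredProd (φ N) U *
      joinDerivation N c s w (centeredProd (φ N) V))) =O[atTop] (fun _ => (1 : ℝ)) := by
  induction V with
  | nil => intro U _; simpa using isBigO_zero (E' := ℂ) (fun _ : ℕ => (1 : ℝ)) atTop
  | cons v V ih =>
    intro U hU
    have hlen : totalLength (v :: V) = v.length + totalLength V := by simp [totalLength]
    have hlenU : totalLength (v :: U) = v.length + totalLength U := by simp [totalLength]
    have h1 := ih (v :: U) (by omega)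
    have h2 : (fun N : ℕ => splitSum v fun u t u' => c s t *
        ((N : ℂ)⁻¹ * φ N (centeredProd (φ N) ((w ++ (u' ++ u)) :: (U ++ V))) +
          meanTrace (φ N) (w ++ (u' ++ u)) * φ N (centeredProd (φ N) (U ++ V))))
        =O[atTop] (fun _ => (1 : ℝ)) := by
      refine isBigO_splitSum fun u t u' hu => IsBigO.const_mul_left (IsBigO.add ?_ ?_) _
      · refine isBigO_one_mul isBigO_natCast_inv (hA _ ?_)
        simp [totalLength] at *; omega
      · refine isBigO_one_mul (hm _ ?_) (hA _ ?_)
        · simp; omega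
        · simp [totalLength] at *; omega
    refine (h1.add h2).congr' ?_ EventuallyEq.rfl
    filter_upwards [eventually_ne_atTop 0] with N hN
    have h3 := IsLoopFunctional.map_mul_joinDerivation_centeredTrace (φ := φ N) (c := c) hN s w v
      (centeredProd (φ N) (U ++ V))
    simp only [← centeredProd_cons] at h3
    rw [← h3, centeredProd_cons (φ N) v V, Derivation.leibniz, ← mul_add, ← map_add,
      centeredProd_cons, centeredProd_append, smul_eq_mul, smul_eq_mul]
    congr 2
    ring

/-- Normalized means of traces and mixed moments of centered traces stay bounded. -/
theorem isBigO_meanTrace_and_centeredProd (hφ : ∀ N, IsLoopFunctional c (φ N)) (n : ℕ) :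
    (∀ w : List Bool, w.length < n →
      (fun N => meanTrace (φ N) w) =O[atTop] (fun _ => (1 : ℝ))) ∧
    (∀ W, totalLength W < n →
      (fun N => φ N (centeredProd (φ N) W)) =O[atTop] (fun _ => (1 : ℝ))) := by
  -- Every term produced by a loop equation has lost at least the first letter and its partner, so
  -- the induction hypothesis bounds all its factors.
  induction n with
  | zero => simp
  | succ n ih =>
    obtain ⟨hm, hA⟩ := ih
    constructor
    · intro w hw
      cases w with
      | nil =>
        refine (isBigO_refl (fun _ : ℕ => (1 : ℂ)) atTop).trans
          (isBigO_const_const _ one_ne_zero _) |>.congr' ?_ EventuallyEq.rfl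
        filter_upwards [eventually_ne_atTop 0] with N hN
        rw [(hφ N).meanTrace_nil hN]
      | cons s w =>
        have h : (fun N : ℕ => splitSum w fun u t u' => c s t *
            (meanTrace (φ N) u * meanTrace (φ N) u' +
              (N : ℂ)⁻¹ * (N : ℂ)⁻¹ * φ N (centeredProd (φ N) [u, u'])))
            =O[atTop] (fun _ => (1 : ℝ)) := by
          simp only [List.length_cons] at hw
          refine isBigO_splitSum fun u t u' hu => IsBigO.const_mul_left (IsBigO.add ?_ ?_) _
          · exact isBigO_one_mul (hm _ (by omega)) (hm _ (by omega))
          · refine isBigO_one_mul (isBigO_one_mul isBigO_natCast_inv isBigO_natCast_inv) (hA _ ?_)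
            simp [totalLength]; omega
        refine h.congr' ?_ EventuallyEq.rfl
        filter_upwards [eventually_ne_atTop 0] with N hN
        rw [(hφ N).meanTrace_cons hN]
    · intro W hW
      match W with
      | [] =>
        simpa [fun N => (hφ N).map_one] using
          isBigO_const_const (1 : ℂ) (one_ne_zero (α := ℝ)) (atTop : Filter ℕ)
      | [] :: V =>
        simpa [centeredProd_cons, fun N => (hφ N).centeredTrace_nil] using
          isBigO_zero (E' := ℂ) (fun _ : ℕ => (1 : ℝ)) atTop
      | (s :: w) :: V =>
        have hW' : w.length + 1 + totalLength V < n + 1 := by simpa [totalLength] using hW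
        have h1 : (fun N : ℕ => splitSum w fun u t u' => c s t *
            ((N : ℂ)⁻¹ * (φ N (centeredProd (φ N) (u :: u' :: V)) -
              φ N (centeredProd (φ N) [u, u']) * φ N (centeredProd (φ N) V)) +
            (meanTrace (φ N) u * φ N (centeredProd (φ N) (u' :: V)) +
              meanTrace (φ N) u' * φ N (centeredProd (φ N) (u :: V)))))
            =O[atTop] (fun _ => (1 : ℝ)) := by
          refine isBigO_splitSum fun u t u' hu => IsBigO.const_mul_left (IsBigO.add
            (isBigO_one_mul isBigO_natCast_inv (IsBigO.sub (hA _ ?_)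
              (isBigO_one_mul (hA _ ?_) (hA _ ?_))))
            (IsBigO.add (isBigO_one_mul (hm _ ?_) (hA _ ?_))
              (isBigO_one_mul (hm _ ?_) (hA _ ?_)))) _ <;>
          · simp [totalLength] at *; omega
        have h2 := isBigO_joinDerivation (c := c) hm hA s w V [] (by simp [totalLength] at *; omega)
        refine (h1.add h2).congr' ?_ EventuallyEq.rfl
        filter_upwards [eventually_ne_atTop 0] with N hN
        rw [centeredProd_cons (φ N) (s :: w), (hφ N).map_centeredTrace_cons_mul hN]
        simp only [centeredProd_cons, centeredProd_nil, one_mul]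

lemma isBigO_centeredProd (hφ : ∀ N, IsLoopFunctional c (φ N)) (W : List (List Bool)) :
    (fun N => φ N (centeredProd (φ N) W)) =O[atTop] (fun _ => (1 : ℝ)) :=
  (isBigO_meanTrace_and_centeredProd hφ _).2 W (Nat.lt_succ_self _)

lemma isBigO_meanTrace (hφ : ∀ N, IsLoopFunctional c (φ N)) (w : List Bool) :
    (fun N => meanTrace (φ N) w) =O[atTop] (fun _ => (1 : ℝ)) :=
  (isBigO_meanTrace_and_centeredProd hφ _).1 w (Nat.lt_succ_self _)

lemma tendsto_inv_mul_of_isBigO {f : ℕ → ℂ} (hf : f =O[atTop] (fun _ => (1 : ℝ))) :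
    Tendsto (fun N : ℕ => (N : ℂ)⁻¹ * f N) atTop (𝓝 0) := by
  have h1 : (fun N : ℕ => (N : ℂ)⁻¹) =o[atTop] (fun _ => (1 : ℝ)) :=
    (isLittleO_one_iff ℝ).2 (tendsto_inv_atTop_nhds_zero_nat (𝕜 := ℂ))
  have := h1.mul_isBigO hf
  simp only [mul_one] at this
  exact (isLittleO_one_iff ℝ).1 this

lemma tendsto_meanTrace_nil (hφ : ∀ N, IsLoopFunctional c (φ N)) :
    Tendsto (fun N => meanTrace (φ N) []) atTop (𝓝 1) := by
  refine tendsto_const_nhds.congr' ?_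
  filter_upwards [eventually_ne_atTop 0] with N hN
  rw [(hφ N).meanTrace_nil hN]

/-- The hypothesis concerns the products and not their factors: in some applications one factor
tends to `0` while the other is only known to be bounded. -/
lemma tendsto_meanTrace_cons (hφ : ∀ N, IsLoopFunctional c (φ N)) (s : Bool) (w : List Bool)
    (f : ℕ → ℂ)
    (h : ∀ n < w.length, Tendsto (fun N => c s (w.getD n default) *
      (meanTrace (φ N) (w.take n) * meanTrace (φ N) (w.drop (n + 1)))) atTop (𝓝 (f n))) :
    Tendsto (fun N => meanTrace (φ N) (s :: w)) atTop (𝓝 (∑ n ∈ Finset.range w.length, f n)) := by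
  have h1 : Tendsto (fun N : ℕ => splitSum w fun u t u' => c s t *
      (meanTrace (φ N) u * meanTrace (φ N) u' +
        (N : ℂ)⁻¹ * (N : ℂ)⁻¹ * φ N (centeredProd (φ N) [u, u']))) atTop
      (𝓝 (∑ n ∈ Finset.range w.length, f n)) := by
    refine tendsto_finsetSum _ fun n hn => ?_
    have h2 := (tendsto_inv_mul_of_isBigO (isBigO_one_mul isBigO_natCast_inv
      (isBigO_centeredProd hφ [w.take n, w.drop (n + 1)]))).const_mul (c s (w.getD n default))
    have h3 := (h n (Finset.mem_range.1 hn)).add h2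
    rw [mul_zero, add_zero] at h3
    refine h3.congr fun N => ?_
    ring
  refine h1.congr' ?_
  filter_upwards [eventually_ne_atTop 0] with N hN
  rw [(hφ N).meanTrace_cons hN]

lemma tendsto_centeredProd_nil_cons (hφ : ∀ N, IsLoopFunctional c (φ N)) (v : List Bool) :
    Tendsto (fun N => φ N (centeredProd (φ N) [[], v])) atTop (𝓝 0) := by
  simp [centeredProd_cons, fun N => (hφ N).centeredTrace_nil]

lemma tendsto_centeredProd_pair_cons (hφ : ∀ N, IsLoopFunctional c (φ N)) (s : Bool)
    (w v : List Bool) (f g : ℕ → ℂ)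
    (hf : ∀ n < w.length, Tendsto (fun N => c s (w.getD n default) *
      (meanTrace (φ N) (w.take n) * φ N (centeredProd (φ N) [w.drop (n + 1), v]) +
        meanTrace (φ N) (w.drop (n + 1)) * φ N (centeredProd (φ N) [w.take n, v])))
      atTop (𝓝 (f n)))
    (hg : ∀ n < v.length, Tendsto (fun N => c s (v.getD n default) *
      meanTrace (φ N) (w ++ (v.drop (n + 1) ++ v.take n))) atTop (𝓝 (g n))) :
    Tendsto (fun N => φ N (centeredProd (φ N) [s :: w, v])) atTop
      (𝓝 (∑ n ∈ Finset.range w.length, f n + ∑ n ∈ Finset.range v.length, g n)) := by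
  have h1 : Tendsto (fun N : ℕ => splitSum w fun u t u' => c s t *
      ((N : ℂ)⁻¹ * (φ N (centeredProd (φ N) [u, u', v]) -
          φ N (centeredProd (φ N) [u, u']) * φ N (centeredProd (φ N) [v])) +
        (meanTrace (φ N) u * φ N (centeredProd (φ N) [u', v]) +
          meanTrace (φ N) u' * φ N (centeredProd (φ N) [u, v])))) atTop
      (𝓝 (∑ n ∈ Finset.range w.length, f n)) := by
    refine tendsto_finsetSum _ fun n hn => ?_
    have h2 := (tendsto_inv_mul_of_isBigO
      ((isBigO_centeredProd hφ [w.take n, w.drop (n + 1), v]).sub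
        (isBigO_one_mul (isBigO_centeredProd hφ [w.take n, w.drop (n + 1)])
          (isBigO_centeredProd hφ [v])))).const_mul (c s (w.getD n default))
    have h3 := h2.add (hf n (Finset.mem_range.1 hn))
    rw [mul_zero, zero_add] at h3
    refine h3.congr fun N => ?_
    ring
  have h2 : Tendsto (fun N : ℕ => splitSum v fun u t u' => c s t *
      ((N : ℂ)⁻¹ * φ N (centeredProd (φ N) [w ++ (u' ++ u)]) +
        meanTrace (φ N) (w ++ (u' ++ u)))) atTop
      (𝓝 (∑ n ∈ Finset.range v.length, g n)) := by
    refine tendsto_finsetSum _ fun n hn => ?_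
    have h2 := (tendsto_inv_mul_of_isBigO (isBigO_centeredProd hφ
      [w ++ (v.drop (n + 1) ++ v.take n)])).const_mul (c s (v.getD n default))
    have h3 := h2.add (hg n (Finset.mem_range.1 hn))
    rw [mul_zero, zero_add] at h3
    refine h3.congr fun N => ?_
    ring
  refine (h1.add h2).congr' ?_
  filter_upwards [eventually_ne_atTop 0] with N hN
  have h3 := IsLoopFunctional.map_mul_joinDerivation_centeredTrace (φ := φ N) (c := c) hN s w v 1
  rw [centeredProd_cons (φ N) (s :: w), (hφ N).map_centeredTrace_cons_mul hN]
  simp only [centeredProd_cons, centeredProd_nil, mul_one, one_mul, (hφ N).map_one] at h3 ⊢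
  rw [h3]

end CenteredMoments

/-! ### Weighted lattice paths and annular pairings -/

section WeightedPaths

variable {R : Type*} [CommRing R]

/-- Weighted number of nonnegative `±1` paths of length `n` from `0` to `k`; each down step has
weight `α`. -/
def ballotWeight (α : R) : ℕ → ℕ → R
  | 0, 0 => 1
  | 0, _ + 1 => 0
  | n + 1, 0 => α * ballotWeight α n 1
  | n + 1, k + 1 => ballotWeight α n k + α * ballotWeight α n (k + 2)

/-- Weighted number of all `±1` paths of length `n` from `0` to `k ≥ 0`; each down step has
weight `α`. -/
def walkWeight (α : R) : ℕ → ℕ → R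
  | 0, 0 => 1
  | 0, _ + 1 => 0
  | n + 1, 0 => 2 * α * walkWeight α n 1
  | n + 1, k + 1 => walkWeight α n k + α * walkWeight α n (k + 2)

lemma ballotWeight_eq_zero_of_lt (α : R) {n k : ℕ} (h : n < k) : ballotWeight α n k = 0 := by
  induction n generalizing k with
  | zero => obtain ⟨k, rfl⟩ := Nat.exists_eq_succ_of_ne_zero h.ne'; rfl
  | succ n ih =>
    obtain ⟨k, rfl⟩ := Nat.exists_eq_succ_of_ne_zero (by omega : k ≠ 0)
    simp [ballotWeight, ih (by omega : n < k), ih (by omega : n < k + 2)]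

lemma ballotWeight_eq_zero_of_odd (α : R) {n k : ℕ} (h : Odd (n + k)) :
    ballotWeight α n k = 0 := by
  induction n generalizing k with
  | zero => cases k with
    | zero => simp at h
    | succ k => rfl
  | succ n ih => cases k with
    | zero => simp [ballotWeight, ih (k := 1) (by simpa using h)]
    | succ k =>
      have h1 : Odd (n + k) := by rw [Nat.odd_iff] at *; omega
      have h2 : Odd (n + (k + 2)) := by rw [Nat.odd_iff] at *; omega
      simp [ballotWeight, ih h1, ih h2]

/-- Last passage decomposition. -/
lemma sum_ballotWeight_mul (α : R) (n k : ℕ) :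
    ∑ i ∈ Finset.range n, ballotWeight α i k * ballotWeight α (n - 1 - i) 0 =
      ballotWeight α n (k + 1) := by
  induction n generalizing k with
  | zero => rfl
  | succ n ih =>
    rw [Finset.sum_range_succ']
    have e : ∀ i, n + 1 - 1 - (i + 1) = n - 1 - i := fun i => by omega
    cases k with
    | zero =>
      simp only [e, ballotWeight, mul_assoc, ← Finset.mul_sum, ih]
      simp [add_comm]
    | succ k =>
      simp only [e, ballotWeight, mul_assoc, add_mul, Finset.sum_add_distrib, ← Finset.mul_sum, ih]
      simp

lemma sum_ballotWeight_mul' (α : R) (n k : ℕ) :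
    ∑ i ∈ Finset.range n, ballotWeight α i 0 * ballotWeight α (n - 1 - i) k =
      ballotWeight α n (k + 1) := by
  rw [← sum_ballotWeight_mul, ← Finset.sum_range_reflect]
  refine Finset.sum_congr rfl fun i hi => ?_
  rw [Finset.mem_range] at hi
  rw [mul_comm, show n - 1 - (n - 1 - i) = i by omega]

/-- Reflection principle: a walk that hits `-1` becomes, after reflecting its initial piece, a walk
from `-2` to `k`, of displacement `k + 2` and with one down step fewer; hence the factor `α`. -/
lemma ballotWeight_eq_sub (α : R) (n k : ℕ) :
    ballotWeight α n k = walkWeight α n k - α * walkWeight α n (k + 2) := by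
  induction n generalizing k with
  | zero => cases k <;> simp [ballotWeight, walkWeight]
  | succ n ih => cases k <;> simp only [ballotWeight, walkWeight, ih] <;> ring

/-- The ballot theorem. -/
lemma succ_mul_walkWeight (α : R) (n k : ℕ) :
    ((k + 1 : ℕ) : R) * walkWeight α (n + 1) (k + 1) = ((n + 1 : ℕ) : R) * ballotWeight α n k := by
  induction n generalizing k with
  | zero => cases k <;> simp [ballotWeight, walkWeight]
  | succ n ih =>
    cases k with
    | zero =>
      have h3 := ballotWeight_eq_sub α (n + 1) 0
      have h4 := ih 1
      have e : walkWeight α (n + 1 + 1) (0 + 1) =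
        walkWeight α (n + 1) 0 + α * walkWeight α (n + 1) 2 := rfl
      have e2 : ballotWeight α (n + 1) 0 = α * ballotWeight α n 1 := rfl
      rw [e]
      push_cast at *
      linear_combination α * h4 - (n + 1) * e2 - h3
    | succ k =>
      have h1 := ih k
      have h2 : ((k + 2 + 1 : ℕ) : R) * walkWeight α (n + 1) (k + 3) = _ := ih (k + 2)
      have h3 : _ = walkWeight α (n + 1) (k + 1) - α * walkWeight α (n + 1) (k + 3) :=
        ballotWeight_eq_sub α (n + 1) (k + 1)
      have e : walkWeight α (n + 1 + 1) (k + 1 + 1) =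
        walkWeight α (n + 1) (k + 1) + α * walkWeight α (n + 1) (k + 3) := rfl
      have e2 : ballotWeight α (n + 1) (k + 1) =
        ballotWeight α n k + α * ballotWeight α n (k + 2) := rfl
      rw [e]
      push_cast at *
      linear_combination h1 + α * h2 - (n + 1) * e2 - h3

/-- First return decomposition. -/
lemma walkWeight_succ (α : R) (n : ℕ) :
    walkWeight α (n + 1) 0 = 2 * α * ∑ i ∈ Finset.range n,
      walkWeight α i 0 * ballotWeight α (n - 1 - i) 0 ∧
    ∀ k, walkWeight α (n + 1) (k + 1) = 2 * α * ∑ i ∈ Finset.range n,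
      walkWeight α i (k + 1) * ballotWeight α (n - 1 - i) 0 + ballotWeight α n k := by
  induction n with
  | zero =>
    refine ⟨by simp [walkWeight], fun k => ?_⟩
    cases k <;> simp [walkWeight, ballotWeight]
  | succ n ih =>
    obtain ⟨ih0, ih1⟩ := ih
    have e : ∀ i, n + 1 - 1 - (i + 1) = n - 1 - i := fun i => by omega
    have hrec : ∀ m k, walkWeight α (m + 1) (k + 1) =
      walkWeight α m k + α * walkWeight α m (k + 2) := fun _ _ => rfl
    have hrec0 : ∀ m, walkWeight α (m + 1) 0 = 2 * α * walkWeight α m 1 := fun _ => rfl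
    constructor
    · rw [Finset.sum_range_succ', hrec0, ih1 0]
      simp only [e, hrec0, mul_assoc, ← Finset.mul_sum]
      simp [walkWeight]
    · intro k
      have hsum : ∑ i ∈ Finset.range n, walkWeight α (i + 1) (k + 1) * ballotWeight α (n - 1 - i) 0 =
          ∑ i ∈ Finset.range n, walkWeight α i k * ballotWeight α (n - 1 - i) 0 +
          α * ∑ i ∈ Finset.range n, walkWeight α i (k + 2) * ballotWeight α (n - 1 - i) 0 := by
        simp only [hrec, add_mul, mul_assoc, Finset.sum_add_distrib, ← Finset.mul_sum]
      rw [Finset.sum_range_succ', hrec (n + 1) k]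
      simp only [e]
      rw [hsum]
      cases k with
      | zero =>
        rw [ih0, ih1 1]
        simp only [walkWeight, ballotWeight]
        ring
      | succ k =>
        rw [ih1 k, ih1 (k + 2)]
        simp only [walkWeight, ballotWeight]
        ring

/-- The weighted number of noncrossing pairings of two runs of lengths `a` and `b`; a pair inside a
run has weight `α`, a pair joining the runs has weight `β`. -/
def twoRunWeight (α β : R) (a b : ℕ) : R :=
  ∑ k ∈ Finset.range (a + 1), β ^ k * (ballotWeight α a k * ballotWeight α b k)

lemma twoRunWeight_eq_sum (α β : R) {a b K : ℕ} (h : a < K) :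
    twoRunWeight α β a b =
      ∑ k ∈ Finset.range K, β ^ k * (ballotWeight α a k * ballotWeight α b k) := by
  refine Finset.sum_subset (Finset.range_subset_range.2 h) fun k _ hk => ?_
  rw [ballotWeight_eq_zero_of_lt α (by simpa using hk), zero_mul, mul_zero]

lemma twoRunWeight_zero_left (α β : R) (b : ℕ) :
    twoRunWeight α β 0 b = ballotWeight α b 0 := by
  simp [twoRunWeight, ballotWeight]

/-- The first letter of the left run pairs inside its own run, enclosing `i` letters, or with letter
`i` of the right run. Summed over the number `k` of joining pairs, the two cases are the two terms
in the recursion of `ballotWeight α (a + 1)`, by the last passage decompositions. -/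
lemma twoRunWeight_succ_left (α β : R) (a b : ℕ) :
    twoRunWeight α β (a + 1) b =
      ∑ i ∈ Finset.range a, α * (ballotWeight α i 0 * twoRunWeight α β (a - 1 - i) b) +
      ∑ i ∈ Finset.range b, β * (twoRunWeight α β a i * ballotWeight α (b - 1 - i) 0) := by
  have h1 : ∑ i ∈ Finset.range a, α * (ballotWeight α i 0 * twoRunWeight α β (a - 1 - i) b) =
      ∑ k ∈ Finset.range (a + 2), α * (β ^ k * (ballotWeight α a (k + 1) * ballotWeight α b k)) := by
    have : ∀ i, twoRunWeight α β (a - 1 - i) b = ∑ k ∈ Finset.range (a + 2),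
        β ^ k * (ballotWeight α (a - 1 - i) k * ballotWeight α b k) :=
      fun i => twoRunWeight_eq_sum α β (by omega)
    simp only [this, Finset.mul_sum]
    rw [Finset.sum_comm]
    refine Finset.sum_congr rfl fun k _ => ?_
    rw [← sum_ballotWeight_mul', Finset.sum_mul, Finset.mul_sum, Finset.mul_sum]
    exact Finset.sum_congr rfl fun i _ => by ring
  have h2 : ∑ i ∈ Finset.range b, β * (twoRunWeight α β a i * ballotWeight α (b - 1 - i) 0) =
      ∑ k ∈ Finset.range (a + 1),
        β ^ (k + 1) * (ballotWeight α a k * ballotWeight α b (k + 1)) := by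
    simp only [twoRunWeight, Finset.mul_sum, Finset.sum_mul]
    rw [Finset.sum_comm]
    refine Finset.sum_congr rfl fun k _ => ?_
    rw [← sum_ballotWeight_mul, Finset.mul_sum, Finset.mul_sum]
    exact Finset.sum_congr rfl fun i _ => by ring
  rw [h1, h2, twoRunWeight, Finset.sum_range_succ', Finset.sum_range_succ' _ (a + 1)]
  rw [add_right_comm, ← Finset.sum_add_distrib]
  congr 1
  · exact Finset.sum_congr rfl fun k _ => by simp only [ballotWeight]; ring
  · simp only [ballotWeight]; ring

/-- The weighted number of noncrossing annular pairings with at least one through string. -/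
def annularWeight (α β : R) (p q : ℕ) : R :=
  ∑ a ∈ Finset.range (p + 1), (a : R) * β ^ a * walkWeight α p a * walkWeight α q a

/-- Here `d` is the number of down steps. The vanishing part is proved together with the formula
because the case `d = 0` of the induction step uses it. -/
lemma walkWeight_eq (α : R) (n : ℕ) :
    (∀ a d, a + 2 * d = n → walkWeight α n a = α ^ d * (n.choose d : R)) ∧
    (∀ a, (∀ d, a + 2 * d ≠ n) → walkWeight α n a = 0) := by
  induction n with
  | zero =>
    constructor
    · intro a d h
      obtain ⟨rfl, rfl⟩ : a = 0 ∧ d = 0 := by omega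
      simp [walkWeight]
    · intro a h
      cases a with
      | zero => exact absurd rfl (h 0)
      | succ a => rfl
  | succ n ih =>
    obtain ⟨ih1, ih2⟩ := ih
    constructor
    · intro a d h
      cases a with
      | zero =>
        obtain ⟨d, rfl⟩ := Nat.exists_eq_succ_of_ne_zero (by omega : d ≠ 0)
        have hn : n = 2 * d + 1 := by omega
        subst hn
        have h1 := ih1 1 d (by omega)
        have h2 : (2 * d + 1).choose (d + 1) = (2 * d + 1).choose d := by
          rw [← Nat.choose_symm_of_eq_add]; omega
        have h3 : (2 * d + 1 + 1).choose (d + 1) = 2 * (2 * d + 1).choose d := by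
          rw [Nat.choose_succ_succ, h2]; ring
        have h4 : walkWeight α (2 * d + 1 + 1) 0 = 2 * α * walkWeight α (2 * d + 1) 1 := rfl
        rw [h4, h1, Nat.succ_eq_add_one, h3]
        push_cast; ring
      | succ a =>
        simp only [walkWeight]
        rw [ih1 a d (by omega)]
        cases d with
        | zero => rw [ih2 (a + 2) (by intro d; omega)]; simp
        | succ d =>
          rw [ih1 (a + 2) d (by omega), Nat.choose_succ_succ]
          push_cast; ring
    · intro a h
      cases a with
      | zero =>
        simp only [walkWeight]
        rw [ih2 1 fun d hd => h (d + 1) (by omega), mul_zero]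
      | succ a =>
        simp only [walkWeight]
        rw [ih2 a fun d hd => h d (by omega), ih2 (a + 2) fun d hd => h (d + 1) (by omega)]
        simp

lemma walkWeight_eq_zero_of_lt (α : R) {n a : ℕ} (h : n < a) : walkWeight α n a = 0 :=
  (walkWeight_eq α n).2 a fun d => by omega

lemma walkWeight_eq_halfChoose (α : R) {n a : ℕ} (h : a ≤ n) :
    walkWeight α n a = α ^ ((n - a) / 2) * (halfChoose n a : R) := by
  rw [halfChoose]
  split_ifs with he
  · obtain ⟨d, hd⟩ := he
    rw [(walkWeight_eq α n).1 a ((n - a) / 2) (by omega)]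
  · rw [(walkWeight_eq α n).2 a]
    · simp
    · rintro d rfl
      exact he ⟨d, by omega⟩

lemma annularWeight_eq_sum (α β : R) {p q K : ℕ} (h : p < K) :
    annularWeight α β p q =
      ∑ a ∈ Finset.range K, (a : R) * β ^ a * walkWeight α p a * walkWeight α q a := by
  refine Finset.sum_subset (Finset.range_subset_range.2 h) fun k _ hk => ?_
  rw [walkWeight_eq_zero_of_lt α (by simpa using hk), mul_zero, zero_mul]

lemma annularWeight_zero_left (α β : R) (q : ℕ) : annularWeight α β 0 q = 0 := by
  simp [annularWeight]

/-- In the first return decomposition of the walk of length `p + 1`, the returning walks give the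
sum over `i`. The walks that never return give `ballotWeight α p a`, and the ballot theorem trades
the factor `a + 1` on the other walk for `q + 1`, leaving `twoRunWeight`. -/
lemma annularWeight_succ_succ (α β : R) (p q : ℕ) :
    annularWeight α β (p + 1) (q + 1) =
      2 * α * ∑ i ∈ Finset.range p, annularWeight α β i (q + 1) * ballotWeight α (p - 1 - i) 0 +
      ((q + 1 : ℕ) : R) * (β * twoRunWeight α β p q) := by
  have h1 : ∑ i ∈ Finset.range p, annularWeight α β i (q + 1) * ballotWeight α (p - 1 - i) 0 =
      ∑ a ∈ Finset.range (p + 2), (a : R) * β ^ a * walkWeight α (q + 1) a *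
        ∑ i ∈ Finset.range p, walkWeight α i a * ballotWeight α (p - 1 - i) 0 := by
    simp only [Finset.mul_sum]
    rw [Finset.sum_comm]
    refine Finset.sum_congr rfl fun i hi => ?_
    rw [annularWeight_eq_sum α β (K := p + 2) (by rw [Finset.mem_range] at hi; omega),
      Finset.sum_mul]
    exact Finset.sum_congr rfl fun a _ => by ring
  rw [h1, twoRunWeight, annularWeight, Finset.sum_range_succ', Finset.sum_range_succ' _ (p + 1)]
  simp only [Nat.cast_zero, zero_mul, add_zero, Finset.mul_sum (Finset.range (p + 1))]
  rw [← Finset.sum_add_distrib]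
  refine Finset.sum_congr rfl fun a _ => ?_
  rw [(walkWeight_succ α p).2 a]
  linear_combination β ^ (a + 1) * ballotWeight α p a * succ_mul_walkWeight α q a

lemma annularWeight_eq_sum_halfChoose (α β : R) (p q : ℕ) :
    annularWeight α β p q = ∑ a ∈ Finset.Icc 1 (min p q), (a : R) * β ^ a *
      (α ^ ((p - a) / 2) * (halfChoose p a : R)) * (α ^ ((q - a) / 2) * (halfChoose q a : R)) := by
  rw [annularWeight, ← Finset.sum_subset (s₁ := Finset.Icc 1 (min p q))]
  · refine Finset.sum_congr rfl fun a ha => ?_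
    rw [Finset.mem_Icc, le_min_iff] at ha
    rw [walkWeight_eq_halfChoose α ha.2.1, walkWeight_eq_halfChoose α ha.2.2]
  · intro a ha
    simp at ha ⊢; omega
  · intro a ha hna
    simp only [Finset.mem_range, Finset.mem_Icc, le_min_iff, not_and, not_le] at ha hna
    rcases Nat.eq_zero_or_pos a with rfl | hpos
    · simp
    · rw [walkWeight_eq_zero_of_lt α (hna hpos (by omega)), mul_zero]

end WeightedPaths

/-! ### Limits for constant and alternating words -/

section RunWords

open Filter Topology Asymptotics

/-- The word `s, σ s, σ (σ s), …` of length `n`. -/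
def runWord (σ : Bool → Bool) : Bool → ℕ → List Bool
  | _, 0 => []
  | s, n + 1 => s :: runWord σ (σ s) n

variable {σ : Bool → Bool}

@[simp]
lemma length_runWord (s : Bool) (n : ℕ) : (runWord σ s n).length = n := by
  induction n generalizing s with
  | zero => rfl
  | succ n ih => simp [runWord, ih]

lemma runWord_add (s : Bool) (a b : ℕ) :
    runWord σ s (a + b) = runWord σ s a ++ runWord σ (σ^[a] s) b := by
  induction a generalizing s with
  | zero => simp [runWord]
  | succ a ih => rw [add_right_comm]; simp [runWord, ih]

lemma take_runWord (s : Bool) {k n : ℕ} (h : k ≤ n) :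
    (runWord σ s n).take k = runWord σ s k := by
  obtain ⟨m, rfl⟩ := Nat.exists_eq_add_of_le h
  rw [runWord_add]
  simp

lemma drop_runWord (s : Bool) {k n : ℕ} (h : k ≤ n) :
    (runWord σ s n).drop k = runWord σ (σ^[k] s) (n - k) := by
  obtain ⟨m, rfl⟩ := Nat.exists_eq_add_of_le h
  rw [runWord_add]
  simp

lemma getD_runWord (s : Bool) {k n : ℕ} (h : k < n) (d : Bool) :
    (runWord σ s n).getD k d = σ^[k] s := by
  obtain ⟨m, rfl⟩ := Nat.exists_eq_add_of_lt h
  rw [add_assoc, runWord_add, List.getD_append_right _ _ _ _ (by simp)]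
  simp [runWord]

lemma iterate_eq_of_mod_two_eq (hσ : Function.Involutive σ) {m n : ℕ} (h : m % 2 = n % 2)
    (s : Bool) : σ^[m] s = σ^[n] s := by
  rcases Nat.even_or_odd m with hm | hm
  · have hn : Even n := by rw [Nat.even_iff] at *; omega
    rw [hσ.iterate_even hm, hσ.iterate_even hn]
  · have hn : Odd n := by rw [Nat.odd_iff] at *; omega
    rw [hσ.iterate_odd hm, hσ.iterate_odd hn]

lemma tendsto_zero_mul_isBigO {f g : ℕ → ℂ} (hf : Tendsto f atTop (𝓝 0))
    (hg : g =O[atTop] (fun _ => (1 : ℝ))) : Tendsto (fun N => f N * g N) atTop (𝓝 0) := by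
  have := ((isLittleO_one_iff ℝ).2 hf).mul_isBigO hg
  simp only [mul_one] at this
  exact (isLittleO_one_iff ℝ).1 this

variable {c : Bool → Bool → ℂ} {α : ℂ} {φ : ∀ N, EntryPoly N →ₗ[ℂ] ℂ}

/-- If the partner of the first letter encloses an even number of letters, the pair has weight `α`.
Otherwise it encloses an odd run, whose mean tends to `0`, and the weight of the pair is irrelevant.
-/
theorem tendsto_meanTrace_runWord (hφ : ∀ N, IsLoopFunctional c (φ N))
    (hσ : Function.Involutive σ) (hα : ∀ s, c s (σ s) = α) (s : Bool) (n : ℕ) :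
    Tendsto (fun N => meanTrace (φ N) (runWord σ s n)) atTop (𝓝 (ballotWeight α n 0)) := by
  induction n using Nat.strong_induction_on generalizing s with
  | _ n ih =>
    cases n with
    | zero => exact tendsto_meanTrace_nil hφ
    | succ n =>
      have h := tendsto_meanTrace_cons hφ s (runWord σ (σ s) n)
        (fun i => α * (ballotWeight α i 0 * ballotWeight α (n - 1 - i) 0)) ?_
      · rw [length_runWord, ← Finset.mul_sum, sum_ballotWeight_mul'] at h
        exact h
      · intro i hi
        rw [length_runWord] at hi
        rw [take_runWord _ hi.le, drop_runWord _ hi, getD_runWord _ hi,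
          show n - i.succ = n - 1 - i by omega]
        rcases Nat.even_or_odd i with he | ho
        · rw [hσ.iterate_even he, id, hα]
          exact ((ih i (by omega) _).mul (ih _ (by omega) _)).const_mul α
        · have h1 := ih i (by omega) (σ s)
          have h0 : ballotWeight α i 0 = 0 := ballotWeight_eq_zero_of_odd α (by simpa using ho)
          rw [h0] at h1 ⊢
          simpa using (tendsto_zero_mul_isBigO h1 (isBigO_meanTrace hφ _)).const_mul _

/-- A joining pair contributes only if an even number of letters follows the partner in the right
run, so the partner has the parity of `b - 1` and the weight is always the same. The exponent `b +
1` has this parity too and avoids truncated subtraction at `b = 0`. -/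
theorem tendsto_meanTrace_runWord_append (hφ : ∀ N, IsLoopFunctional c (φ N))
    (hσ : Function.Involutive σ) (hα : ∀ s, c s (σ s) = α) (hc : ∀ s t, c (σ s) (σ t) = c s t)
    (s t : Bool) (a b : ℕ) :
    Tendsto (fun N => meanTrace (φ N) (runWord σ s a ++ runWord σ t b)) atTop
      (𝓝 (twoRunWeight α (c s (σ^[b + 1] t)) a b)) := by
  induction a using Nat.strong_induction_on generalizing s t b with
  | _ a ih =>
    cases a with
    | zero =>
      rw [twoRunWeight_zero_left]
      exact tendsto_meanTrace_runWord hφ hσ hα t b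
    | succ a =>
      set β := c s (σ^[b + 1] t) with hβ
      have h := tendsto_meanTrace_cons hφ s (runWord σ (σ s) a ++ runWord σ t b)
        (fun n => if n < a then
            α * (ballotWeight α n 0 * twoRunWeight α β (a - 1 - n) b)
          else β * (twoRunWeight α β a (n - a) * ballotWeight α (b - 1 - (n - a)) 0)) ?_
      · rw [List.length_append, length_runWord, length_runWord, Finset.sum_range_add] at h
        rw [twoRunWeight_succ_left]
        refine h.congr' .rfl |>.trans (le_of_eq (congrArg 𝓝 (congrArg₂ (· + ·) ?_ ?_)))
        · exact Finset.sum_congr rfl fun n hn => by rw [if_pos (Finset.mem_range.1 hn)]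
        · simp
      · intro n hn
        rw [List.length_append, length_runWord, length_runWord] at hn
        by_cases hna : n < a
        · rw [if_pos hna, List.take_append_of_le_length (by simp; omega),
            List.drop_append_of_le_length (by simp; omega), List.getD_append _ _ _ _ (by simpa),
            take_runWord _ hna.le, drop_runWord _ hna, getD_runWord _ hna,
            show a - (n + 1) = a - 1 - n by omega]
          have h1 := tendsto_meanTrace_runWord hφ hσ hα (σ s) n
          rcases Nat.even_or_odd n with he | ho
          · have h2 := ih (a - 1 - n) (by omega) s t b
            have h3 : σ^[n + 1] (σ s) = s := by
              rw [← Function.iterate_succ_apply, hσ.iterate_even (by simpa [Nat.even_add_one]), id]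
            rw [h3, hσ.iterate_even he, id, hα]
            exact (h1.mul h2).const_mul α
          · have h0 : ballotWeight α n 0 = 0 := ballotWeight_eq_zero_of_odd α (by simpa using ho)
            rw [h0] at h1 ⊢
            simpa using (tendsto_zero_mul_isBigO h1 (isBigO_meanTrace hφ _)).const_mul _
        · obtain ⟨i, rfl⟩ := Nat.exists_eq_add_of_le (not_lt.1 hna)
          have hi : i < b := by omega
          have htake : (runWord σ (σ s) a ++ runWord σ t b).take (a + i) =
              runWord σ (σ s) a ++ runWord σ t i := by
            rw [List.take_append]
            simp [take_runWord _ hi.le]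
          have hdrop : (runWord σ (σ s) a ++ runWord σ t b).drop (a + i + 1) =
              runWord σ (σ^[i + 1] t) (b - 1 - i) := by
            rw [add_assoc, List.drop_append, List.drop_of_length_le (by simp)]
            simp only [length_runWord, Nat.add_sub_cancel_left, List.nil_append]
            rw [drop_runWord _ hi, show b - (i + 1) = b - 1 - i by omega]
          have hget : (runWord σ (σ s) a ++ runWord σ t b).getD (a + i) default = σ^[i] t := by
            rw [List.getD_append_right _ _ _ _ (by simp)]
            simp only [length_runWord, Nat.add_sub_cancel_left]
            rw [getD_runWord _ hi]
          rw [if_neg hna, htake, hdrop, hget, Nat.add_sub_cancel_left]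
          have h1 := ih a (by omega) (σ s) t i
          have h2 := tendsto_meanTrace_runWord hφ hσ hα (σ^[i + 1] t) (b - 1 - i)
          rcases Nat.even_or_odd (b - 1 - i) with he | ho
          · have h3 : c s (σ^[i] t) = β := by
              rw [hβ, iterate_eq_of_mod_two_eq hσ (n := b + 1) (by rw [Nat.even_iff] at he; omega)]
            -- Both runs that remain inside the joining pair have moved one step along `σ`;
            -- invariance of `c` under `σ` keeps their weight equal to `β`.
            rw [Function.iterate_succ_apply', hc, h3] at h1
            rw [h3]
            exact (h1.mul h2).const_mul β
          · have h0 : ballotWeight α (b - 1 - i) 0 = 0 :=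
              ballotWeight_eq_zero_of_odd α (by simpa using ho)
            rw [h0] at h2 ⊢
            have h4 := (tendsto_zero_mul_isBigO h2 (isBigO_meanTrace hφ
              (runWord σ (σ s) a ++ runWord σ t i))).const_mul (c s (σ^[i] t))
            simpa [mul_comm] using h4

/-- The limiting covariance of two run words of lengths `p` and `q`. -/
noncomputable def runCovariance (σ : Bool → Bool) (c : Bool → Bool → ℂ) (α : ℂ) (s t : Bool)
    (p q : ℕ) : ℂ :=
  (q : ℂ)⁻¹ * ∑ j ∈ Finset.range q, annularWeight α (c s (σ^[j] t)) p q

/-- Applying `σ` to `s` shifts the rotations `j` by one, and the sum over a full cycle does not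
change. -/
lemma runCovariance_map_left (hσ : Function.Involutive σ) (hc : ∀ s t, c (σ s) (σ t) = c s t)
    {q : ℕ} (hq : ∀ t, σ^[q] t = t) (s t : Bool) (p : ℕ) :
    runCovariance σ c α (σ s) t p q = runCovariance σ c α s t p q := by
  have h1 : ∀ j, c (σ s) (σ^[j] t) = c s (σ^[j + 1] t) := by
    intro j
    rw [Function.iterate_succ_apply', ← hc s, hσ]
  have h2 := Finset.sum_range_succ' (fun j => annularWeight α (c s (σ^[j] t)) p q) q
  rw [Finset.sum_range_succ, hq, Function.iterate_zero, id] at h2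
  simp only [runCovariance, h1]
  rw [add_right_cancel h2]

/-- This is `annularWeight_succ_succ` averaged over rotations. Its factor `2` becomes the two
symmetric sums exchanged by `n ↦ p - 1 - n`, one for each of the two pieces that can carry the
through strings. -/
lemma runCovariance_succ_succ (s t : Bool) (p q : ℕ) :
    runCovariance σ c α s t (p + 1) (q + 1) =
      ∑ n ∈ Finset.range p, α * (ballotWeight α n 0 * runCovariance σ c α s t (p - 1 - n) (q + 1) +
        ballotWeight α (p - 1 - n) 0 * runCovariance σ c α s t n (q + 1)) +
      ∑ j ∈ Finset.range (q + 1), c s (σ^[j] t) * twoRunWeight α (c s (σ^[j] t)) p q := by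
  have h1 : ∑ n ∈ Finset.range p,
        ballotWeight α n 0 * runCovariance σ c α s t (p - 1 - n) (q + 1) =
      ∑ n ∈ Finset.range p,
        ballotWeight α (p - 1 - n) 0 * runCovariance σ c α s t n (q + 1) := by
    rw [← Finset.sum_range_reflect]
    refine Finset.sum_congr rfl fun n hn => ?_
    rw [Finset.mem_range] at hn
    rw [show p - 1 - (p - 1 - n) = n by omega]
  have hq : ((q + 1 : ℕ) : ℂ) ≠ 0 := by exact_mod_cast Nat.succ_ne_zero q
  rw [← Finset.mul_sum, Finset.sum_add_distrib, h1]
  simp only [runCovariance, annularWeight_succ_succ, Finset.sum_add_distrib, ← Finset.mul_sum,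
    mul_add, inv_mul_cancel_left₀ hq]
  congr 1
  have h2 : ∑ n ∈ Finset.range p, ballotWeight α (p - 1 - n) 0 *
      (((q + 1 : ℕ) : ℂ)⁻¹ * ∑ j ∈ Finset.range (q + 1), annularWeight α (c s (σ^[j] t)) n (q + 1)) =
      ((q + 1 : ℕ) : ℂ)⁻¹ * ∑ j ∈ Finset.range (q + 1), ∑ i ∈ Finset.range p,
        annularWeight α (c s (σ^[j] t)) i (q + 1) * ballotWeight α (p - 1 - i) 0 := by
    rw [Finset.sum_comm, Finset.mul_sum]
    refine Finset.sum_congr rfl fun n _ => ?_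
    rw [← Finset.sum_mul]; ring
  rw [h2]
  ring

/-- The conditions on the lengths say that both words are periodic as cyclic words. Hence every
rotation of the second word is again a run, and cuts of the wrong parity leave two odd pieces in the
first word. -/
theorem tendsto_centeredProd_runWord (hφ : ∀ N, IsLoopFunctional c (φ N))
    (hσ : Function.Involutive σ) (hα : ∀ s, c s (σ s) = α) (hc : ∀ s t, c (σ s) (σ t) = c s t)
    (t : Bool) (q : ℕ) (hq : ∀ t, σ^[q + 1] t = t) (s : Bool) (p : ℕ)
    (hp : (∀ s, σ s = s) ∨ Even p) :
    Tendsto (fun N => φ N (centeredProd (φ N) [runWord σ s p, runWord σ t (q + 1)])) atTop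
      (𝓝 (runCovariance σ c α s t p (q + 1))) := by
  induction p using Nat.strong_induction_on generalizing s with
  | _ p ih =>
    cases p with
    | zero =>
      have : runCovariance σ c α s t 0 (q + 1) = 0 := by
        simp [runCovariance, annularWeight_zero_left]
      rw [this]
      exact tendsto_centeredProd_nil_cons hφ _
    | succ p =>
      have h := tendsto_centeredProd_pair_cons hφ s (runWord σ (σ s) p) (runWord σ t (q + 1))
        (fun n => α * (ballotWeight α n 0 * runCovariance σ c α s t (p - 1 - n) (q + 1) +
          ballotWeight α (p - 1 - n) 0 * runCovariance σ c α s t n (q + 1)))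
        (fun j => c s (σ^[j] t) * twoRunWeight α (c s (σ^[j] t)) p q) ?_ ?_
      · rw [length_runWord, length_runWord, ← runCovariance_succ_succ] at h
        exact h
      · intro n hn
        rw [length_runWord] at hn
        rw [take_runWord _ hn.le, drop_runWord _ hn, getD_runWord _ hn,
          show p - (n + 1) = p - 1 - n by omega]
        have h1 := tendsto_meanTrace_runWord hφ hσ hα (σ s) n
        have h2 := tendsto_meanTrace_runWord hφ hσ hα (σ^[n + 1] (σ s)) (p - 1 - n)
        by_cases hcase : (∀ s, σ s = s) ∨ Even n
        · have hcn : c s (σ^[n] (σ s)) = α := by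
            rcases hcase with hid | he
            · rw [Function.iterate_fixed (hid _), hα]
            · rw [hσ.iterate_even he, id, hα]
          have hs' : σ^[n + 1] (σ s) = s := by
            rcases hcase with hid | he
            · rw [Function.iterate_fixed (hid _), hid]
            · rw [← Function.iterate_succ_apply, hσ.iterate_even (by simpa [Nat.even_add_one]), id]
          have hpn : (∀ s, σ s = s) ∨ Even (p - 1 - n) := by
            rcases hcase with hid | he
            · exact Or.inl hid
            · refine hp.imp id fun hp' => ?_
              rw [Nat.even_iff] at *; omega
          have h3 := ih n (by omega) (σ s) hcase
          have h4 := ih (p - 1 - n) (by omega) s hpn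
          rw [runCovariance_map_left hσ hc hq] at h3
          rw [hcn]
          rw [hs'] at h2 ⊢
          exact ((h1.mul h4).add (h2.mul h3)).const_mul α
        -- The word has even length and `n` is odd, so `n` and `p - 1 - n` are both odd. Both means
        -- tend to `0` while the covariances stay bounded.
        · rw [not_or, Nat.not_even_iff_odd] at hcase
          have hp' : Even (p + 1) := hp.resolve_left hcase.1
          have hn' := hcase.2
          have h01 : ballotWeight α n 0 = 0 := ballotWeight_eq_zero_of_odd α (by simpa using hn')
          have h02 : ballotWeight α (p - 1 - n) 0 = 0 := by
            refine ballotWeight_eq_zero_of_odd α ?_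
            rw [Nat.odd_iff] at *
            rw [Nat.even_iff] at hp'
            omega
          rw [h01] at h1 ⊢
          rw [h02] at h2 ⊢
          have h3 := ((tendsto_zero_mul_isBigO h1 (isBigO_centeredProd hφ
            [runWord σ (σ^[n + 1] (σ s)) (p - 1 - n), runWord σ t (q + 1)])).add
            (tendsto_zero_mul_isBigO h2 (isBigO_centeredProd hφ
              [runWord σ (σ s) n, runWord σ t (q + 1)]))).const_mul (c s (σ^[n] (σ s)))
          simpa using h3
      · intro j hj
        rw [length_runWord] at hj
        -- Since `σ^[q + 1]` is the identity, removing letter `j` and reading on cyclically gives a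
        -- single run.
        have hv : runWord σ (σ^[j + 1] t) (q - j) ++ runWord σ t j =
            runWord σ (σ^[j + 1] t) q := by
          have hsplit := runWord_add (σ := σ) (σ^[j + 1] t) (q - j) j
          rw [show q - j + j = q by omega, ← Function.iterate_add_apply,
            show q - j + (j + 1) = q + 1 by omega, hq] at hsplit
          exact hsplit.symm
        rw [take_runWord _ hj.le, drop_runWord _ hj, getD_runWord _ hj,
          show q + 1 - (j + 1) = q - j by omega, hv]
        have h1 := tendsto_meanTrace_runWord_append hφ hσ hα hc (σ s) (σ^[j + 1] t) p q
        rw [hq, Function.iterate_succ_apply', hc] at h1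
        rw [Function.iterate_succ_apply']
        exact h1.const_mul _

end RunWords

/-! ### Elliptic matrices satisfy the loop equation -/

section EllipticMatrices

open Filter Topology

/-- The covariance weights of the pair `(X, X*)` for an elliptic matrix `X`. -/
noncomputable def ellipticWeight (γ : ℝ) (s t : Bool) : ℂ := if s = t then (γ : ℂ) else 1

/-- The entries of the normalized matrix `X` (index `false`) and of `X*` (index `true`). -/
noncomputable def ellipticEntries {Ω : Type*} {N : ℕ} (Y : Ω → Matrix (Fin N) (Fin N) ℂ) (ω : Ω)
    (k : Bool × Fin N × Fin N) : ℂ :=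
  if k.1 then (normalizedMatrix Y ω).conjTranspose k.2.1 k.2.2
  else normalizedMatrix Y ω k.2.1 k.2.2

/-- The pair of indices `{i, j}` in increasing order. -/
def orderedPair {N : ℕ} (i j : Fin N) : {e : Fin N × Fin N // e.1 ≤ e.2} :=
  if h : i ≤ j then ⟨(i, j), h⟩ else ⟨(j, i), (not_le.1 h).le⟩

lemma orderedPair_eq {N : ℕ} {i j k l : Fin N} (h : orderedPair i j = orderedPair k l) :
    (k = i ∧ l = j) ∨ (k = j ∧ l = i) := by
  unfold orderedPair at h
  split_ifs at h <;> simp only [Subtype.mk.injEq, Prod.mk.injEq] at h <;>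
    obtain ⟨rfl, rfl⟩ := h <;> simp

/-- Reads off the `(i, j)` entry from the pair of entries indexed by `orderedPair i j`. -/
noncomputable def entryOfPair {N : ℕ} (i j : Fin N) : ℂ × ℂ →L[ℝ] ℂ :=
  if i ≤ j then ContinuousLinearMap.fst ℝ ℂ ℂ else ContinuousLinearMap.snd ℝ ℂ ℂ

lemma entryOfPair_apply {N : ℕ} (A : Matrix (Fin N) (Fin N) ℂ) (i j : Fin N) :
    entryOfPair i j (A (orderedPair i j).1.1 (orderedPair i j).1.2,
      A (orderedPair i j).1.2 (orderedPair i j).1.1) = A i j := by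
  by_cases h : i ≤ j <;> simp [entryOfPair, orderedPair, h]

namespace IsGaussianElliptic

variable {Ω : Type*} [MeasurableSpace Ω] {P : Measure Ω} {N : ℕ} {γ : ℝ}
  {Y : Ω → Matrix (Fin N) (Fin N) ℂ}

lemma hasGaussianLaw_pair (hY : IsGaussianElliptic γ Y P) (i j : Fin N) :
    HasGaussianLaw (fun ω => (Y ω i j, Y ω j i)) P := by
  by_cases h : i = j
  · subst h
    exact (hY.diag_gaussian i).map_fun
      ((ContinuousLinearMap.id ℝ ℂ).prod (ContinuousLinearMap.id ℝ ℂ))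
  · exact hY.offDiag_gaussian i j h

lemma hasGaussianLaw_entry (hY : IsGaussianElliptic γ Y P) (i j : Fin N) :
    HasGaussianLaw (fun ω => Y ω i j) P :=
  (hY.hasGaussianLaw_pair i j).fst

/-- The independent Gaussian pairs are jointly Gaussian, and the entries of `X` and `X*` are a
real-linear image of them, conjugation being linear over `ℝ`. -/
lemma hasGaussianLaw_entries (hY : IsGaussianElliptic γ Y P) :
    HasGaussianLaw (ellipticEntries Y) P := by
  have h := iIndepFun.hasGaussianLaw
    (fun e : {e : Fin N × Fin N // e.1 ≤ e.2} => hY.hasGaussianLaw_pair e.1.1 e.1.2) hY.indep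
  let r : ℝ := (Real.sqrt N)⁻¹
  let E (i j : Fin N) : ({e : Fin N × Fin N // e.1 ≤ e.2} → ℂ × ℂ) →L[ℝ] ℂ :=
    r • (entryOfPair i j).comp (ContinuousLinearMap.proj (orderedPair i j))
  let L : ({e : Fin N × Fin N // e.1 ≤ e.2} → ℂ × ℂ) →L[ℝ] (Bool × Fin N × Fin N → ℂ) :=
    ContinuousLinearMap.pi fun k =>
      if k.1 then (Complex.conjCLE : ℂ →L[ℝ] ℂ).comp (E k.2.2 k.2.1) else E k.2.1 k.2.2
  refine (h.map_fun L).congr (Filter.Eventually.of_forall fun ω => ?_)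
  ext ⟨b, i, j⟩
  cases b <;>
    simp [L, E, ellipticEntries, normalizedMatrix, entryOfPair_apply, r, Matrix.smul_apply,
      Matrix.conjTranspose_apply]

lemma integral_entry (hY : IsGaussianElliptic γ Y P) (i j : Fin N) : ∫ ω, Y ω i j ∂P = 0 := by
  by_cases h : i = j
  · subst h; exact hY.diag_mean i
  · exact hY.offDiag_mean i j h

lemma indepFun_entry (hY : IsGaussianElliptic γ Y P) {i j k l : Fin N}
    (h : orderedPair i j ≠ orderedPair k l) :
    IndepFun (fun ω => Y ω i j) (fun ω => Y ω k l) P := by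
  have h1 := (hY.indep.indepFun h).comp (φ := entryOfPair i j) (ψ := entryOfPair k l)
    (entryOfPair i j).measurable (entryOfPair k l).measurable
  simpa only [Function.comp_def, entryOfPair_apply] using h1

lemma integral_entry_mul_entry (hY : IsGaussianElliptic γ Y P) (i j k l : Fin N) :
    ∫ ω, Y ω i j * Y ω k l ∂P = if k = j ∧ l = i then (γ : ℂ) else 0 := by
  by_cases h : orderedPair i j = orderedPair k l
  · rcases orderedPair_eq h with ⟨rfl, rfl⟩ | ⟨rfl, rfl⟩
    · by_cases hkl : k = l
      · subst hkl; simpa [sq] using hY.diag_sq k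
      · simpa [sq, hkl] using hY.offDiag_sq k l hkl
    · by_cases hkl : k = l
      · subst hkl; simpa [sq] using hY.diag_sq k
      · simpa using hY.offDiag_mul l k (Ne.symm hkl)
  · rw [(hY.indepFun_entry h).integral_fun_mul_eq_mul_integral
      (hY.hasGaussianLaw_entry i j).aemeasurable.aestronglyMeasurable
      (hY.hasGaussianLaw_entry k l).aemeasurable.aestronglyMeasurable, hY.integral_entry, zero_mul,
      if_neg]
    rintro ⟨rfl, rfl⟩
    refine h ?_
    unfold orderedPair
    by_cases h1 : k ≤ l <;> by_cases h2 : l ≤ k <;> simp [h1, h2]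
    · exact ⟨le_antisymm h2 h1, le_antisymm h1 h2⟩
    · exact absurd (le_total k l) (by simp [h1, h2])

lemma integral_entry_mul_star_entry (hY : IsGaussianElliptic γ Y P) (i j k l : Fin N) :
    ∫ ω, Y ω i j * star (Y ω k l) ∂P = if k = i ∧ l = j then 1 else 0 := by
  have hsq : ∀ k l, ∫ ω, ‖Y ω k l‖ ^ 2 ∂P = 1 → ∫ ω, Y ω k l * star (Y ω k l) ∂P = 1 := by
    intro k l h
    have h1 : ∀ ω, Y ω k l * star (Y ω k l) = ((‖Y ω k l‖ ^ 2 : ℝ) : ℂ) := fun ω => by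
      rw [← Complex.normSq_eq_norm_sq]
      exact Complex.mul_conj _
    simp_rw [h1]
    rw [integral_complex_ofReal, h, Complex.ofReal_one]
  by_cases h : orderedPair i j = orderedPair k l
  · rcases orderedPair_eq h with ⟨rfl, rfl⟩ | ⟨rfl, rfl⟩
    · by_cases hkl : k = l
      · subst hkl; simpa using hsq k k (hY.diag_norm_sq k)
      · simpa using hsq k l (hY.offDiag_norm_sq k l hkl)
    · by_cases hkl : k = l
      · subst hkl; simpa using hsq k k (hY.diag_norm_sq k)
      · simpa [hkl] using hY.offDiag_mul_conj l k (Ne.symm hkl)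
  · have h1 : IndepFun (fun ω => Y ω i j) (fun ω => star (Y ω k l)) P :=
      (hY.indepFun_entry h).comp (φ := id) (ψ := star) measurable_id (by fun_prop)
    rw [h1.integral_fun_mul_eq_mul_integral
      (hY.hasGaussianLaw_entry i j).aemeasurable.aestronglyMeasurable
      (hY.hasGaussianLaw_entry k l).aemeasurable.aestronglyMeasurable.star, hY.integral_entry,
      zero_mul, if_neg]
    rintro ⟨rfl, rfl⟩
    exact h rfl

lemma integral_ellipticEntries (hY : IsGaussianElliptic γ Y P) (k : Bool × Fin N × Fin N) :
    ∫ ω, ellipticEntries Y ω k ∂P = 0 := by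
  obtain ⟨b, i, j⟩ := k
  cases b
  · simp only [ellipticEntries, normalizedMatrix, Matrix.smul_apply, smul_eq_mul, if_false,
      Bool.false_eq_true]
    rw [integral_const_mul, hY.integral_entry, mul_zero]
  · simp only [ellipticEntries, normalizedMatrix, Matrix.conjTranspose_apply, Matrix.smul_apply,
      smul_eq_mul, if_true, star_mul']
    have h := integral_conj (μ := P) (f := fun ω => Y ω j i) (𝕜 := ℂ)
    rw [hY.integral_entry, map_zero] at h
    rw [integral_const_mul]
    exact mul_eq_zero_of_right _ h

/-- The moments prescribed on the diagonal are those that make one formula valid for all index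
pairs. -/
lemma integral_ellipticEntries_mul (hY : IsGaussianElliptic γ Y P) (s t : Bool)
    (i j k l : Fin N) :
    ∫ ω, ellipticEntries Y ω (s, i, j) * ellipticEntries Y ω (t, k, l) ∂P =
      if k = j ∧ l = i then (N : ℂ)⁻¹ * ellipticWeight γ s t else 0 := by
  set r : ℂ := (((Real.sqrt N)⁻¹ : ℝ) : ℂ) with hr
  have hr2 : r * r = (N : ℂ)⁻¹ := by
    rw [hr, ← Complex.ofReal_mul, ← mul_inv, Real.mul_self_sqrt (Nat.cast_nonneg N)]
    simp
  have hstar : star r = r := Complex.conj_ofReal _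
  have hconj : ∀ i j k l, ∫ ω, star (Y ω i j) * star (Y ω k l) ∂P =
      if k = j ∧ l = i then (γ : ℂ) else 0 := by
    intro i j k l
    have h := integral_conj (μ := P) (f := fun ω => Y ω i j * Y ω k l) (𝕜 := ℂ)
    rw [hY.integral_entry_mul_entry] at h
    simp only [map_mul] at h
    refine h.trans ?_
    split_ifs
    · exact Complex.conj_ofReal γ
    · simp
  have hpull : ∀ f g : Ω → ℂ, ∫ ω, r * f ω * (r * g ω) ∂P = (N : ℂ)⁻¹ * ∫ ω, f ω * g ω ∂P := by
    intro f g
    rw [← hr2, ← integral_const_mul]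
    exact integral_congr_ae (Filter.Eventually.of_forall fun ω => by ring)
  cases s <;> cases t <;>
    simp only [ellipticEntries, normalizedMatrix, Matrix.conjTranspose_apply, Matrix.smul_apply,
      smul_eq_mul, if_true, if_false, Bool.false_eq_true, star_mul', ← hr, hstar, ellipticWeight,
      reduceCtorEq]
  · rw [hpull (fun ω => Y ω i j) (fun ω => Y ω k l), hY.integral_entry_mul_entry]
    simp
  · rw [hpull (fun ω => Y ω i j) (fun ω => star (Y ω l k)), hY.integral_entry_mul_star_entry]
    simp [and_comm]
  · rw [hpull (fun ω => star (Y ω j i)) (fun ω => Y ω k l)]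
    simp only [mul_comm (star _)]
    rw [hY.integral_entry_mul_star_entry]
    simp [eq_comm]
  · rw [hpull (fun ω => star (Y ω j i)) (fun ω => star (Y ω l k)), hconj]
    simp [and_comm]

/-- The expectation of a polynomial in the entries of `X` and `X*`. -/
noncomputable def expectation (hY : IsGaussianElliptic γ Y P) : EntryPoly N →ₗ[ℂ] ℂ where
  toFun p := ∫ ω, MvPolynomial.eval (ellipticEntries Y ω) p ∂P
  map_add' p q := by
    simp only [map_add]
    exact integral_add (integrable_eval_of_hasGaussianLaw hY.hasGaussianLaw_entries p)
      (integrable_eval_of_hasGaussianLaw hY.hasGaussianLaw_entries q)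
  map_smul' a p := by
    simp only [MvPolynomial.smul_eval, RingHom.id_apply, smul_eq_mul]
    exact integral_const_mul _ _

lemma expectation_apply (hY : IsGaussianElliptic γ Y P) (p : EntryPoly N) :
    hY.expectation p = ∫ ω, MvPolynomial.eval (ellipticEntries Y ω) p ∂P := rfl

lemma isLoopFunctional_expectation (hY : IsGaussianElliptic γ Y P) :
    IsLoopFunctional (ellipticWeight γ) hY.expectation where
  map_one := by
    have := hY.hasGaussianLaw_entries.isProbabilityMeasure
    simp [expectation_apply]
  map_X_mul s i j p := by
    simp only [expectation_apply, map_mul, MvPolynomial.eval_X]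
    rw [integral_mul_eval_of_hasGaussianLaw hY.hasGaussianLaw_entries hY.integral_ellipticEntries,
      Fintype.sum_prod_type, Finset.mul_sum]
    refine Finset.sum_congr rfl fun t _ => ?_
    simp only [hY.integral_ellipticEntries_mul]
    rw [Finset.sum_eq_single (j, i)]
    · simp [mul_assoc]
    · rintro ⟨k, l⟩ _ hkl
      rw [if_neg, zero_mul]
      rintro ⟨rfl, rfl⟩
      exact hkl rfl
    · simp

end IsGaussianElliptic

lemma map_eval_wordMatrix {Ω : Type*} {N : ℕ} (Y : Ω → Matrix (Fin N) (Fin N) ℂ) (ω : Ω)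
    (w : List Bool) :
    (wordMatrix N w).map (MvPolynomial.eval (ellipticEntries Y ω)) =
      (w.map fun s : Bool => if s then (normalizedMatrix Y ω).conjTranspose
        else normalizedMatrix Y ω).prod := by
  induction w with
  | nil => simp [wordMatrix_nil]
  | cons s w ih =>
    rw [wordMatrix_cons, Matrix.map_mul, ih, List.map_cons, List.prod_cons]
    congr 1
    ext i j
    cases s <;> simp [letterMatrix, ellipticEntries]

lemma eval_wordTrace {Ω : Type*} {N : ℕ} (Y : Ω → Matrix (Fin N) (Fin N) ℂ) (ω : Ω)
    (w : List Bool) :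
    MvPolynomial.eval (ellipticEntries Y ω) (wordTrace N w) =
      (w.map fun s : Bool => if s then (normalizedMatrix Y ω).conjTranspose
        else normalizedMatrix Y ω).prod.trace := by
  rw [← map_eval_wordMatrix, wordTrace, Matrix.trace, map_sum]
  rfl

lemma runWord_id (s : Bool) (n : ℕ) : runWord id s n = List.replicate n s := by
  induction n with
  | zero => rfl
  | succ n ih => simp [runWord, ih, List.replicate_succ]

lemma eval_wordTrace_run_false {Ω : Type*} {N : ℕ} (Y : Ω → Matrix (Fin N) (Fin N) ℂ) (ω : Ω)
    (n : ℕ) :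
    MvPolynomial.eval (ellipticEntries Y ω) (wordTrace N (runWord id false n)) =
      (normalizedMatrix Y ω ^ n).trace := by
  simp [eval_wordTrace, runWord_id]

lemma eval_wordTrace_run_true {Ω : Type*} {N : ℕ} (Y : Ω → Matrix (Fin N) (Fin N) ℂ) (ω : Ω)
    (n : ℕ) :
    MvPolynomial.eval (ellipticEntries Y ω) (wordTrace N (runWord id true n)) =
      ((normalizedMatrix Y ω).conjTranspose ^ n).trace := by
  simp [eval_wordTrace, runWord_id]

lemma eval_wordTrace_run_not {Ω : Type*} {N : ℕ} (Y : Ω → Matrix (Fin N) (Fin N) ℂ) (ω : Ω)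
    (n : ℕ) :
    MvPolynomial.eval (ellipticEntries Y ω) (wordTrace N (runWord not false (2 * n))) =
      ((normalizedMatrix Y ω * (normalizedMatrix Y ω).conjTranspose) ^ n).trace := by
  rw [eval_wordTrace]
  congr 1
  induction n with
  | zero => simp [runWord]
  | succ n ih =>
    rw [show 2 * (n + 1) = 2 * n + 1 + 1 by ring]
    simp only [runWord, List.map_cons, List.prod_cons, Bool.not_false, Bool.not_true, ih, pow_succ']
    simp [mul_assoc]

lemma kappaTwo_eq_expectation {Ω : Type*} [MeasurableSpace Ω] {P : Measure Ω} {N : ℕ} {γ : ℝ}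
    {Y : Ω → Matrix (Fin N) (Fin N) ℂ} (hY : IsGaussianElliptic γ Y P) (u v : List Bool) :
    kappaTwo (fun ω => MvPolynomial.eval (ellipticEntries Y ω) (wordTrace N u))
      (fun ω => MvPolynomial.eval (ellipticEntries Y ω) (wordTrace N v)) P =
      hY.expectation (centeredProd hY.expectation [u, v]) := by
  have hφ := hY.isLoopFunctional_expectation
  rw [centeredProd_cons, centeredProd_cons, centeredProd_nil, mul_one,
    IsLoopFunctional.map_centeredTrace_mul, hφ.map_centeredTrace, mul_zero, sub_zero, mul_comm,
    IsLoopFunctional.map_centeredTrace_mul]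
  simp only [kappaTwo, IsGaussianElliptic.expectation_apply, map_mul]
  simp only [mul_comm]

lemma runCovariance_id (c : Bool → Bool → ℂ) (α : ℂ) (s t : Bool) (p q : ℕ) :
    runCovariance id c α s t p (q + 1) = annularWeight α (c s t) p (q + 1) := by
  have hq : ((q + 1 : ℕ) : ℂ) ≠ 0 := by exact_mod_cast Nat.succ_ne_zero q
  rw [runCovariance]
  simp only [Function.iterate_id, id, Finset.sum_const, Finset.card_range, nsmul_eq_mul]
  rw [inv_mul_cancel_left₀ hq]

/-- Half of the rotations of the alternating word match equal letters, with weight `γ`, and half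
match `X` with `X*`, with weight `1`. -/
lemma runCovariance_not (γ : ℝ) (α : ℂ) (p q : ℕ) :
    runCovariance not (ellipticWeight γ) α false false p (2 * (q + 1)) =
      (annularWeight α γ p (2 * (q + 1)) + annularWeight α 1 p (2 * (q + 1))) / 2 := by
  have hsum : ∀ (F : ℂ → ℂ) (n : ℕ),
      ∑ j ∈ Finset.range (2 * n), F (ellipticWeight γ false (not^[j] false)) =
        n * (F γ + F 1) := by
    intro F n
    induction n with
    | zero => simp
    | succ n ih =>
      have h0 : not^[2 * n] false = false := by
        rw [Bool.involutive_not.iterate_even (even_two_mul n)]; rfl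
      rw [show 2 * (n + 1) = 2 * n + 1 + 1 by ring, Finset.sum_range_succ, Finset.sum_range_succ,
        ih, Function.iterate_succ_apply', h0]
      simp only [ellipticWeight, if_true, Bool.not_false, reduceCtorEq, if_false]
      push_cast; ring
  rw [runCovariance, hsum fun β => annularWeight α β p (2 * (q + 1))]
  have hq : ((q + 1 : ℕ) : ℂ) ≠ 0 := by exact_mod_cast Nat.succ_ne_zero q
  push_cast at *
  field_simp

lemma annularWeight_self (γ : ℝ) (p q : ℕ) :
    annularWeight (γ : ℂ) γ p q = ((∑ a ∈ Finset.Icc 1 (min p q),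
      (a : ℝ) * γ ^ ((p + q) / 2) * halfChoose p a * halfChoose q a : ℝ) : ℂ) := by
  rw [annularWeight_eq_sum_halfChoose]
  push_cast
  refine Finset.sum_congr rfl fun a ha => ?_
  rw [Finset.mem_Icc, le_min_iff] at ha
  by_cases hp : Even (p - a)
  · by_cases hq : Even (q - a)
    · have : (p + q) / 2 = a + (p - a) / 2 + (q - a) / 2 := by
        rw [Nat.even_iff] at hp hq; omega
      rw [this, pow_add, pow_add]; ring
    · simp [halfChoose, hq]
  · simp [halfChoose, hp]

lemma annularWeight_one_right (γ : ℝ) (p q : ℕ) :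
    annularWeight (γ : ℂ) 1 p q = ((∑ a ∈ Finset.Icc 1 (min p q),
      (a : ℝ) * γ ^ ((p + q) / 2 - a) * halfChoose p a * halfChoose q a : ℝ) : ℂ) := by
  rw [annularWeight_eq_sum_halfChoose]
  push_cast
  refine Finset.sum_congr rfl fun a ha => ?_
  rw [Finset.mem_Icc, le_min_iff] at ha
  by_cases hp : Even (p - a)
  · by_cases hq : Even (q - a)
    · have : (p + q) / 2 - a = (p - a) / 2 + (q - a) / 2 := by
        rw [Nat.even_iff] at hp hq; omega
      rw [this, pow_add, one_pow]; ring
    · simp [halfChoose, hq]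
  · simp [halfChoose, hp]

/-- For even lengths only even numbers `2a` of through strings occur. The resulting factor `2`
cancels the average over two weights in `runCovariance_not`. -/
lemma annularWeight_one_left (β : ℂ) (p q : ℕ) :
    annularWeight (1 : ℂ) β (2 * p) (2 * q) = ∑ a ∈ Finset.Icc 1 (min p q),
      2 * ((a : ℂ) * β ^ (2 * a) * ((2 * p).choose (p - a) : ℂ) * ((2 * q).choose (q - a) : ℂ)) := by
  rw [annularWeight_eq_sum_halfChoose]
  symm
  refine Finset.sum_of_injOn (fun a => 2 * a) (fun a _ b _ h => by simpa using h) ?_ ?_ ?_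
  · intro a ha
    simp only [Finset.coe_Icc, Set.mem_Icc, le_min_iff] at ha ⊢
    omega
  · intro a ha hna
    have hodd : ¬ Even (2 * p - a) := by
      intro he
      rw [Finset.mem_Icc, le_min_iff] at ha
      refine hna ⟨a / 2, ?_, ?_⟩
      · simp only [Finset.coe_Icc, Set.mem_Icc, le_min_iff]
        rw [Nat.even_iff] at he
        omega
      · rw [Nat.even_iff] at he
        change 2 * (a / 2) = a
        omega
    simp [halfChoose, hodd]
  · intro a ha
    rw [Finset.mem_Icc, le_min_iff] at ha
    have h1 : ∀ n, halfChoose (2 * n) (2 * a) = (2 * n).choose (n - a) := by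
      intro n
      rw [halfChoose, ← Nat.mul_sub, if_pos (even_two_mul _), Nat.mul_div_cancel_left _ two_pos]
    simp only [h1, one_pow, one_mul]
    push_cast; ring

end EllipticMatrices

/-! ### The three limiting covariances -/

theorem theorem1p3 (γ : ℝ) (hγ : γ ∈ Set.Icc (-1 : ℝ) 1)
    (Ω : ℕ → Type*) [∀ N, MeasurableSpace (Ω N)]
    (P : ∀ N, Measure (Ω N)) [∀ N, IsProbabilityMeasure (P N)]
    (Y : ∀ N, Ω N → Matrix (Fin N) (Fin N) ℂ)
    (hY : ∀ N, IsGaussianElliptic γ (Y N) (P N))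
    (X : ∀ N, Ω N → Matrix (Fin N) (Fin N) ℂ)
    (hX : ∀ N, X N = normalizedMatrix (Y N)) :
    -- the traces are square integrable, so that all covariances below are well defined
    (∀ r N : ℕ,
      MemLp (fun ω => (X N ω ^ r).trace) 2 (P N) ∧
      MemLp (fun ω => ((X N ω).conjTranspose ^ r).trace) 2 (P N) ∧
      MemLp (fun ω => ((X N ω * (X N ω).conjTranspose) ^ r).trace) 2 (P N)) ∧
    ∀ p q : ℕ, 1 ≤ p → 1 ≤ q →
      Filter.Tendsto
        (fun N => kappaTwo (fun ω => (X N ω ^ p).trace) (fun ω => (X N ω ^ q).trace) (P N))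
        Filter.atTop
        (nhds ((∑ a ∈ Finset.Icc 1 (min p q),
          (a : ℝ) * γ ^ ((p + q) / 2) * halfChoose p a * halfChoose q a : ℝ) : ℂ)) ∧
      Filter.Tendsto
        (fun N => kappaTwo (fun ω => (X N ω ^ p).trace)
          (fun ω => ((X N ω).conjTranspose ^ q).trace) (P N))
        Filter.atTop
        (nhds ((∑ a ∈ Finset.Icc 1 (min p q),
          (a : ℝ) * γ ^ ((p + q) / 2 - a) * halfChoose p a * halfChoose q a : ℝ) : ℂ)) ∧
      Filter.Tendsto
        (fun N => kappaTwo (fun ω => ((X N ω * (X N ω).conjTranspose) ^ p).trace)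
          (fun ω => ((X N ω * (X N ω).conjTranspose) ^ q).trace) (P N))
        Filter.atTop
        (nhds ((∑ a ∈ Finset.Icc 1 (min p q),
          (a : ℝ) * (γ ^ (2 * a) + 1) * (2 * p).choose (p - a) * (2 * q).choose (q - a) : ℝ)
            : ℂ)) := by
  obtain rfl : X = fun N => normalizedMatrix (Y N) := funext hX
  have hφ : ∀ N, IsLoopFunctional (ellipticWeight γ) (hY N).expectation :=
    fun N => (hY N).isLoopFunctional_expectation
  have hc : ∀ s t, ellipticWeight γ (not s) (not t) = ellipticWeight γ s t := by
    intro s t; simp [ellipticWeight]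
  refine ⟨fun r N => ?_, fun p q hp hq => ?_⟩
  · have h := fun w => memLp_eval_of_hasGaussianLaw (hY N).hasGaussianLaw_entries (wordTrace N w)
      (r := 2) (by simp)
    refine ⟨?_, ?_, ?_⟩
    · simpa only [eval_wordTrace_run_false] using h (runWord id false r)
    · simpa only [eval_wordTrace_run_true] using h (runWord id true r)
    · simpa only [eval_wordTrace_run_not] using h (runWord not false (2 * r))
  · obtain ⟨q, rfl⟩ := Nat.exists_eq_add_of_le' hq
    have hid := fun t => tendsto_centeredProd_runWord (σ := id) (α := (γ : ℂ)) hφ (fun _ => rfl)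
      (fun s => by simp [ellipticWeight]) (fun _ _ => rfl) t q (fun t => by simp) false p
      (Or.inl fun _ => rfl)
    simp only [← kappaTwo_eq_expectation, runCovariance_id] at hid
    refine ⟨?_, ?_, ?_⟩
    · have h := hid false
      simp only [eval_wordTrace_run_false] at h
      rwa [ellipticWeight, if_pos rfl, annularWeight_self] at h
    · have h := hid true
      simp only [eval_wordTrace_run_false, eval_wordTrace_run_true] at h
      rwa [ellipticWeight, if_neg (by simp), annularWeight_one_right] at h
    -- Neighbouring letters of the alternating word are `X` and `X*`, so pairs inside a word have
    -- weight `1` and `γ` enters only through the through strings.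
    · have h := tendsto_centeredProd_runWord (σ := not) (α := 1) hφ Bool.involutive_not
        (fun s => by simp [ellipticWeight]) hc false (2 * q + 1)
        (fun t => by rw [Bool.involutive_not.iterate_even ⟨q + 1, by ring⟩, id]) false (2 * p)
        (Or.inr (even_two_mul p))
      rw [show 2 * q + 1 + 1 = 2 * (q + 1) by ring, runCovariance_not, annularWeight_one_left,
        annularWeight_one_left] at h
      simp only [← kappaTwo_eq_expectation, eval_wordTrace_run_not] at h
      refine h.trans (le_of_eq (congrArg nhds ?_))
      rw [← Finset.sum_add_distrib, Finset.sum_div]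
      push_cast
      refine Finset.sum_congr rfl fun a _ => ?_
      rw [one_pow]
      ring
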